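/- For a finite graded poset $P$ of rank $n+1$ with rank function $\rho$, minimum $\hat 0$ and maximum $\hat 1$, let $$\Psi(P)=\sum_{\hat 0<x_1<\dots<x_k<\hat 1} z_1z_2\cdots z_n\in\mathbb Z\langle \mathbf a,\mathbf b\rangle ,$$ where the sum is over all chains (including the empty one, $k=0$), and $z_i=\mathbf b$ if $i\in\{\rho(x_1),\dots,\rho(x_k)\}$ and $z_i=\mathbf a-\mathbf b$ otherwise. Put $\mathbf c=\mathbf a+\mathbf b$ and $\mathbf d=\mathbf a\mathbf b+\mathbf b\mathbf a$. For a convex polytope $Q$ let $\Psi(Q)$ denote $\Psi$ of its face poset (all faces, including $\emptyset$ and $Q$, ordered by inclusion); written as a polynomial in $\mathbf c$ and $\mathbf d$, this is the $\mathbf c\mathbf d$-index of $Q$. For a face $F$ of $Q$ let $\Psi(Q/F)$ denote $\Psi$ of the interval $[F,Q]$ of the face poset, which is the face poset of the face figure $Q/F$. Theorem. Let $Q\subset\mathbb R^n$ be a convex polytope and let $H=\{x : l(x)=t\}$ be a hyperplane ($l\neq 0$ a linear functional, $t\in\mathbb R$) that meets the relative interior of $Q$ and does not contain $Q$ (if $Q$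 is full-dimensional, this just says that $H$ meets the interior of $Q$). Put $Q^+=Q\cap\{l\ge t\}$, $Q^-=Q\cap\{l\le t\}$, $\widehat Q=Q\cap H$, and $\hat\sigma=\sigma\cap H$ for a face $\sigma$ of $Q$. Then $$\Psi(Q)=\Psi(Q^+)+\Psi(Q^-)-\Psi(\widehat Q)\cdot\mathbf c-\sum_{\sigma}\Psi(\hat\sigma)\cdot\mathbf d\cdot\Psi(\widehat Q/\hat\sigma),$$ where the sum is over all proper faces $\sigma$ of $Q$ that meet both open halfspaces $\{l>t\}$ and $\{l<t\}$. -/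

import Mathlib

namespace CdIndex

/-- The two noncommuting letters `a` and `b`. -/
inductive Letter : Type
  | a
  | b

/-- The ring `ℤ⟨a, b⟩` of noncommutative integer polynomials in `a` and `b`. -/
abbrev ABPoly : Type := FreeAlgebra ℤ Letter

/-- The variable `a`. -/
def aVar : ABPoly := FreeAlgebra.ι ℤ Letter.a

/-- The variable `b`. -/
def bVar : ABPoly := FreeAlgebra.ι ℤ Letter.b

/-- `c = a + b`. -/
def cVar : ABPoly := aVar + bVar

/-- `d = a b + b a`. -/
def dVar : ABPoly := aVar * bVar + bVar * aVar

section Poset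

variable (P : Type*) [PartialOrder P] [BoundedOrder P]

/-- The rank `ρ(x)` of an element of a finite graded poset with least element: the length of the
longest chain that ends in `x`. -/
noncomputable def rk {P : Type*} [PartialOrder P] (x : P) : ℕ := (Order.height x).toNat

/-- The chains `0̂ < x₁ < ⋯ < xₖ < 1̂`, each recorded as the set `{x₁, …, xₖ}`. -/
def innerChains : Set (Finset P) :=
  {C | IsChain (· ≤ ·) (C : Set P) ∧ ∀ x ∈ C, ⊥ < x ∧ x < ⊤}

open Classical in
/-- The weight `w(C) = z₁ ⋯ zₙ` of a chain in a graded poset of rank `n + 1`, with `zᵢ = b` if `i` is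
the rank of an element of the chain and `zᵢ = a - b` otherwise. -/
noncomputable def chainWeight (C : Finset P) : ABPoly :=
  ((List.range (rk (⊤ : P) - 1)).map fun i =>
    if ∃ x ∈ C, rk x = i + 1 then bVar else aVar - bVar).prod

/-- The `ab`-index `Ψ(P) = ∑ w(C)` of a finite graded poset `P` with `0̂` and `1̂`, the sum being over
all chains `0̂ < x₁ < ⋯ < xₖ < 1̂`. As an element of `ℤ⟨a, b⟩` written in terms of `c = a + b` and
`d = ab + ba`, it is the `cd`-index of `P` when `P` is Eulerian. -/
noncomputable def abIndex : ABPoly :=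
  ∑ᶠ C ∈ innerChains P, chainWeight P C

end Poset

section Polytope

variable {E : Type*} [NormedAddCommGroup E] [NormedSpace ℝ E]

/-- A convex polytope: the convex hull of finitely many points. -/
def IsPolytope (Q : Set E) : Prop := ∃ s : Finset E, Q = convexHull ℝ (s : Set E)

/-- The face poset of `Q` under inclusion. A face is the empty set or the set of maximizers on `Q` of
a linear functional; in particular `∅` and `Q` itself are faces. -/
abbrev FacePoset (Q : Set E) : Type _ := {F : Set E // IsExposed ℝ Q F}

instance (Q : Set E) : BoundedOrder (FacePoset Q) where
  top := ⟨Q, IsExposed.refl Q⟩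
  le_top F := F.2.subset
  bot := ⟨∅, isExposed_empty⟩
  bot_le F := Set.empty_subset F.1

/-- `Ψ(Q)`: the `cd`-index of the face poset of `Q`. -/
noncomputable def Psi (Q : Set E) : ABPoly := abIndex (FacePoset Q)

/-- `Ψ(Q/F)`: the `cd`-index of the face figure of `Q` at its face `F`, whose face poset is the
interval `[F, Q]` of the face poset of `Q`. -/
noncomputable def PsiFaceFigure {Q : Set E} (F : FacePoset Q) : ABPoly := abIndex (Set.Ici F)

/-- The hyperplane `l(x) = t`. -/
def hyperplane (l : StrongDual ℝ E) (t : ℝ) : Set E := {x | l x = t}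

/-- The closed halfspace `l(x) ≥ t`. -/
def upperHalf (l : StrongDual ℝ E) (t : ℝ) : Set E := {x | t ≤ l x}

/-- The closed halfspace `l(x) ≤ t`. -/
def lowerHalf (l : StrongDual ℝ E) (t : ℝ) : Set E := {x | l x ≤ t}

/-- If `F` is a face of `Q`, then `F ∩ H` is a face of `Q ∩ H`. -/
theorem isExposed_inter {Q F : Set E} (H : Set E) (hF : IsExposed ℝ Q F) :
    IsExposed ℝ (Q ∩ H) (F ∩ H) := by
  rintro ⟨z, hzF, hzH⟩
  obtain ⟨m, rfl⟩ := hF ⟨z, hzF⟩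
  refine ⟨m, Set.ext fun x => ⟨?_, ?_⟩⟩
  · rintro ⟨⟨hxQ, hx⟩, hxH⟩
    exact ⟨⟨hxQ, hxH⟩, fun y hy => hx y hy.1⟩
  · rintro ⟨⟨hxQ, hxH⟩, hx⟩
    exact ⟨⟨hxQ, fun y hy => (hzF.2 y hy).trans (hx z ⟨hzF.1, hzH⟩)⟩, hxH⟩

/-- The face `F ∩ H` of `Q ∩ H` cut out by a face `F` of `Q`. -/
def FacePoset.cut {Q : Set E} (F : FacePoset Q) (H : Set E) : FacePoset (Q ∩ H) :=
  ⟨F.1 ∩ H, isExposed_inter H F.2⟩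

/-- The proper faces of `Q` that meet both open halfspaces `l(x) > t` and `l(x) < t`. -/
def splitFaces (Q : Set E) (l : StrongDual ℝ E) (t : ℝ) : Set (FacePoset Q) :=
  {F | F.1 ≠ Q ∧ (∃ x ∈ F.1, t < l x) ∧ (∃ x ∈ F.1, l x < t)}

end Polytope

end CdIndex

/-! Write e = a - b. Splitting a chain at its least element gives, for an interval of a graded
poset, Ψ[x,T] = e^(ρ(T)-ρ(x)-1) + ∑ e^(ρ(y)-ρ(x)-1) b Ψ[y,T] over x < y < T
(`intervalIndex_eq_sum`). The theorem is the case x = ∅ of an identity about the proper faces x of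
Q̂, proved by downward induction on x.

Geometry. A proper face of Q̂ is either old, that is, a face of Q lying in H, or new, that is, σ̂
for a unique proper face σ of Q that meets both open sides. The new ones form an up-set. A face of
Q⁺ that leaves H is F ∩ {l ≥ t} for a unique face F of Q meeting {l > t}, and the interval above it
in Q⁺ is isomorphic to [F,Q] (`IsPolytope.intervalIndex_inter_upperHalf`). If F meets both sides,
then also [F,Q] ≅ [F̂,Q̂], with ranks lowered by one (`IsPolytope.intervalIndex_inter_hyperplane`).
The common reason is that faces are extreme sets: a face containing the cut of such an F contains F.

Algebra (`cut_recursion`). Let h(x) and q(x) be the indices of [x,Q̂] and [x,Q], let k(x) be the sum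
of those of [x,Q⁺] and [x,Q⁻], and let G(x) = h(x)c + ∑ Ψ[x,u] d h(u) over new u > x. Then k = G + c
h at new faces and k = G + q at old ones. Faces of Q strictly on one side contribute equally to k
and q; a split face contributes twice to k and once to q, and its cut appears once more in k. The
relations c = e + 2b and d = eb + bc turn this surplus into the recursion for G. The empty face is
old.

Ranks. Heights in a face poset equal dimension plus one, because this number increases strictly
along inclusions and faces whose dimensions differ by at least two have a face in between
(`IsPolytope.exists_isExposed_between`). -/

namespace CdIndex

/-! ### Chain sums over intervals of a finite poset, and their recursion. -/

section ChainSums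

variable {α β : Type*} [PartialOrder α] [PartialOrder β]

/-- `a - b`. -/
def eVar : ABPoly := aVar - bVar

open Classical in
/-- The letter contributed in rank `i` by a chain `C`. -/
noncomputable def letterAt (r : α → ℕ) (C : Finset α) (i : ℕ) : ABPoly :=
  if ∃ y ∈ C, r y = i then bVar else eVar

/-- The word contributed by a chain `C` in the ranks strictly between `i` and `j`. -/
noncomputable def chainWord (r : α → ℕ) (C : Finset α) (i j : ℕ) : ABPoly :=
  ((List.range' (i + 1) (j - i - 1)).map (letterAt r C)).prod

open Classical in
/-- The elements of `F` strictly between `x` and `t`. -/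
noncomputable def between (F : Finset α) (x t : α) : Finset α :=
  F.filter fun y => x < y ∧ y < t

open Classical in
/-- The chains consisting of elements of `F` strictly between `x` and `t`. -/
noncomputable def chainsBetween (F : Finset α) (x t : α) : Finset (Finset α) :=
  (between F x t).powerset.filter fun C => IsChain (· ≤ ·) (C : Set α)

/-- The `ab`-index of the interval from `x` to `t` of the poset `F` with rank function `r`. -/
noncomputable def intervalIndex (F : Finset α) (r : α → ℕ) (x t : α) : ABPoly :=
  ∑ C ∈ chainsBetween F x t, chainWord r C (r x) (r t)

theorem mem_between {F : Finset α} {x t y : α} : y ∈ between F x t ↔ y ∈ F ∧ x < y ∧ y < t := by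
  simp [between]

theorem mem_chainsBetween {F : Finset α} {x t : α} {C : Finset α} :
    C ∈ chainsBetween F x t ↔ C ⊆ between F x t ∧ IsChain (· ≤ ·) (C : Set α) := by
  simp [chainsBetween]

theorem intervalIndex_congr {F G : Finset α} {r : α → ℕ} {x t : α}
    (h : between F x t = between G x t) : intervalIndex F r x t = intervalIndex G r x t := by
  simp only [intervalIndex, chainsBetween, h]

theorem chainWord_empty {γ : Type*} (r : γ → ℕ) (i j : ℕ) :
    chainWord r (∅ : Finset γ) i j = eVar ^ (j - i - 1) := by
  have : letterAt r (∅ : Finset γ) = fun _ => eVar := by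
    funext i; simp [letterAt]
  simp [chainWord, this, List.map_const']

-- The word factors at the rank of the least element `y`: below it only the letter a - b occurs, at
-- it b, and above it `y` is invisible.
open Classical in
theorem chainWord_insert {γ : Type*} {r : γ → ℕ} {y : γ} {C : Finset γ} {i j : ℕ} (hi : i < r y)
    (hj : r y < j) (hC : ∀ z ∈ C, r y < r z) :
    chainWord r (insert y C) i j = eVar ^ (r y - i - 1) * bVar * chainWord r C (r y) j := by
  have hsplit : List.range' (i + 1) (j - i - 1) =
      List.range' (i + 1) (r y - i - 1) ++ [r y] ++ List.range' (r y + 1) (j - r y - 1) := by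
    obtain ⟨m, hm⟩ := Nat.exists_eq_add_of_le (show i + 1 ≤ r y from hi)
    obtain ⟨k, hk⟩ := Nat.exists_eq_add_of_le (show r y + 1 ≤ j from hj)
    have h1 : [r y] = List.range' (i + 1 + m) 1 := by rw [hm]; rfl
    rw [h1, show r y - i - 1 = m by omega, show j - r y - 1 = k by omega,
      show j - i - 1 = m + 1 + k by omega, show r y + 1 = i + 1 + (m + 1) by omega,
      List.range'_append_1, List.range'_append_1]
  rw [chainWord, hsplit]
  simp only [List.map_append, List.prod_append, List.map_cons, List.map_nil, List.prod_cons,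
    List.prod_nil, mul_one]
  congr 1
  · congr 1
    · have : ∀ k ∈ List.range' (i + 1) (r y - i - 1), letterAt r (insert y C) k = eVar := by
        intro k hk
        rw [List.mem_range'_1] at hk
        rw [letterAt, if_neg]
        rintro ⟨z, hz, rfl⟩
        rcases Finset.mem_insert.1 hz with rfl | hz
        · omega
        · have := hC z hz
          omega
      rw [List.map_congr_left this, List.map_const', List.prod_replicate, List.length_range']
    · rw [letterAt, if_pos ⟨y, Finset.mem_insert_self _ _, rfl⟩]
  · rw [chainWord]
    congr 1
    refine List.map_congr_left fun k hk => ?_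
    rw [List.mem_range'_1] at hk
    have : (∃ z ∈ insert y C, r z = k) ↔ ∃ z ∈ C, r z = k := by
      constructor
      · rintro ⟨z, hz, rfl⟩
        rcases Finset.mem_insert.1 hz with rfl | hz
        · omega
        · exact ⟨z, hz, rfl⟩
      · rintro ⟨z, hz, rfl⟩
        exact ⟨z, Finset.mem_insert_of_mem hz, rfl⟩
    simp only [letterAt, this]

theorem exists_min_of_isChain {C : Finset α} (hC : IsChain (· ≤ ·) (C : Set α))
    (hne : C.Nonempty) : ∃ y ∈ C, ∀ z ∈ C, y ≤ z := by
  obtain ⟨y, hy⟩ := C.exists_minimal hne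
  refine ⟨y, hy.1, fun z hz => ?_⟩
  rcases hC.total hy.1 hz with h | h
  · exact h
  · exact hy.2 hz h

/-- The recursion for `ab`-indices obtained by removing the least element of a chain. -/
theorem intervalIndex_eq_sum {F : Finset α} {r : α → ℕ} {x t : α}
    (hx : ∀ y ∈ F, x < y → r x < r y) (ht : ∀ y ∈ F, y < t → r y < r t)
    (hF : ∀ y ∈ F, ∀ z ∈ F, y < z → r y < r z) :
    intervalIndex F r x t = eVar ^ (r t - r x - 1) +
      ∑ y ∈ between F x t, eVar ^ (r y - r x - 1) * bVar * intervalIndex F r y t := by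
  classical
  have hempty : (∅ : Finset α) ∈ chainsBetween F x t := by
    simp [mem_chainsBetween]
  rw [intervalIndex, ← Finset.add_sum_erase _ _ hempty, chainWord_empty]
  congr 1
  simp only [intervalIndex, Finset.mul_sum]
  rw [Finset.sum_sigma']
  symm
  refine Finset.sum_bij (fun p _ => insert p.1 p.2) ?_ ?_ ?_ ?_
  · rintro ⟨y, C⟩ h
    simp only [Finset.mem_sigma, mem_between, mem_chainsBetween] at h
    obtain ⟨⟨hyF, hxy, hyt⟩, hC, hch⟩ := h
    rw [Finset.mem_erase, mem_chainsBetween]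
    refine ⟨Finset.insert_ne_empty _ _, ?_, ?_⟩
    · refine Finset.insert_subset (mem_between.2 ⟨hyF, hxy, hyt⟩) fun z hz => ?_
      obtain ⟨h1, h2, h3⟩ := mem_between.1 (hC hz)
      exact mem_between.2 ⟨h1, hxy.trans h2, h3⟩
    · rw [Finset.coe_insert]
      exact hch.insert fun z hz _ => Or.inl (mem_between.1 (hC hz)).2.1.le
  · rintro ⟨y, C⟩ h ⟨y', C'⟩ h' heq
    simp only [Finset.mem_sigma, mem_between, mem_chainsBetween] at h h' heq
    have hlt : ∀ z ∈ C, y < z := fun z hz => (mem_between.1 (h.2.1 hz)).2.1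
    have hlt' : ∀ z ∈ C', y' < z := fun z hz => (mem_between.1 (h'.2.1 hz)).2.1
    have hy : y = y' := by
      have h1 : y ∈ insert y' C' := heq ▸ Finset.mem_insert_self _ _
      have h2 : y' ∈ insert y C := heq ▸ Finset.mem_insert_self _ _
      rcases Finset.mem_insert.1 h1 with h1 | h1
      · exact h1
      rcases Finset.mem_insert.1 h2 with h2 | h2
      · exact h2.symm
      exact absurd ((hlt' _ h1).trans (hlt _ h2)) (lt_irrefl _)
    subst hy
    have hC : C = C' := by
      rw [← Finset.erase_insert (fun hy => lt_irrefl _ (hlt y hy)), heq,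
        Finset.erase_insert (fun hy => lt_irrefl _ (hlt' y hy))]
    subst hC
    rfl
  · intro C hC
    rw [Finset.mem_erase, mem_chainsBetween] at hC
    obtain ⟨hne, hC, hch⟩ := hC
    obtain ⟨y, hy, hmin⟩ := exists_min_of_isChain hch (Finset.nonempty_iff_ne_empty.2 hne)
    refine ⟨⟨y, C.erase y⟩, ?_, Finset.insert_erase hy⟩
    rw [Finset.mem_sigma, mem_chainsBetween]
    refine ⟨hC hy, fun z hz => ?_, hch.mono (by simp)⟩
    obtain ⟨hzy, hz⟩ := Finset.mem_erase.1 hz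
    obtain ⟨h1, h2, h3⟩ := mem_between.1 (hC hz)
    exact mem_between.2 ⟨h1, lt_of_le_of_ne (hmin z hz) (Ne.symm hzy), h3⟩
  · rintro ⟨y, C⟩ h
    simp only [Finset.mem_sigma, mem_between, mem_chainsBetween] at h
    refine (chainWord_insert (hx y h.1.1 h.1.2.1) (ht y h.1.1 h.1.2.2) fun z hz => ?_).symm
    obtain ⟨h1, h2, h3⟩ := mem_between.1 (h.2.1 hz)
    exact hF y h.1.1 z h1 h2

/-- Intervals that are isomorphic up to a shift of the ranks have the same `ab`-index. -/
theorem intervalIndex_transport {F A : Finset α} {G : Finset β} {r : α → ℕ} {s : β → ℕ}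
    {φ : α → β} {t : α} (c : ℕ) (hr : ∀ y ∈ F, ∀ z ∈ F, y < z → r y < r z)
    (hs : ∀ y ∈ G, ∀ z ∈ G, y < z → s y < s z) (hAF : A ⊆ F)
    (hA : ∀ y ∈ A, ∀ z ∈ F, y < z → z ∈ A) (ht : t ∈ A)
    (hφ : ∀ y ∈ A, φ y ∈ G) (hlt : ∀ y ∈ A, ∀ z ∈ A, φ y < φ z ↔ y < z)
    (hsurj : ∀ y ∈ A, ∀ z ∈ G, φ y < z → ∃ y' ∈ A, φ y' = z)
    (hinj : ∀ y ∈ A, ∀ z ∈ A, φ y = φ z → y = z)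
    (hrank : ∀ y ∈ A, s (φ y) + c = r y) :
    ∀ y ∈ A, intervalIndex F r y t = intervalIndex G s (φ y) (φ t) := by
  -- Both sides satisfy the recursion of `intervalIndex_eq_sum`, so induction on the corank of `y`
  -- compares them term by term; the exponents are rank differences, so the shift `c` drops out.
  have key : ∀ k, ∀ y ∈ A, r t - r y = k →
      intervalIndex F r y t = intervalIndex G s (φ y) (φ t) := by
    intro k
    induction k using Nat.strong_induction_on with
    | _ k ih =>
    intro y hy hk
    rw [intervalIndex_eq_sum (fun z hz => hr y (hAF hy) z hz) (fun z hz => hr z hz t (hAF ht)) hr,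
      intervalIndex_eq_sum (fun z hz => hs _ (hφ y hy) z hz) (fun z hz => hs z hz _ (hφ t ht)) hs]
    congr 1
    · congr 1
      have := hrank y hy
      have := hrank t ht
      omega
    · refine Finset.sum_bij (fun z _ => φ z) ?_ ?_ ?_ ?_
      · intro z hz
        obtain ⟨hzF, hyz, hzt⟩ := mem_between.1 hz
        have hzA := hA y hy z hzF hyz
        exact mem_between.2 ⟨hφ z hzA, (hlt y hy z hzA).2 hyz, (hlt z hzA t ht).2 hzt⟩
      · intro z hz w hw h
        obtain ⟨hzF, hyz, hzt⟩ := mem_between.1 hz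
        obtain ⟨hwF, hyw, hwt⟩ := mem_between.1 hw
        exact hinj z (hA y hy z hzF hyz) w (hA y hy w hwF hyw) h
      · intro w hw
        obtain ⟨hwG, hyw, hwt⟩ := mem_between.1 hw
        obtain ⟨z, hz, rfl⟩ := hsurj y hy w hwG hyw
        exact ⟨z, mem_between.2 ⟨hAF hz, (hlt y hy z hz).1 hyw, (hlt z hz t ht).1 hwt⟩, rfl⟩
      · intro z hz
        obtain ⟨hzF, hyz, hzt⟩ := mem_between.1 hz
        have hzA := hA y hy z hzF hyz
        have h1 := hr y (hAF hy) z hzF hyz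
        have h2 := hr z hzF t (hAF ht) hzt
        rw [ih (r t - r z) (by omega) z hzA rfl]
        congr 3
        have := hrank y hy
        have := hrank z hzA
        omega
  exact fun y hy => key _ y hy rfl

end ChainSums

/-! ### From the `ab`-index of an abstract poset to chain sums in an ambient order. -/

section AbIndex

variable {P : Type*} [PartialOrder P] {α : Type*} [PartialOrder α]

/-- In a poset graded by `r`, the height is given by `r`. -/
theorem rk_add_eq_of_graded [OrderBot P] (r : P → ℕ) (hr : StrictMono r)
    (hgap : ∀ x y : P, x < y → r x + 2 ≤ r y → ∃ z, x < z ∧ z < y) (x : P) :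
    rk x + r ⊥ = r x := by
  have hbot : ∀ y : P, r ⊥ ≤ r y := fun y => hr.monotone bot_le
  -- Filling gaps repeatedly yields an element exactly one rank below `y`; this gives the lower
  -- bound on the height.
  have hcover : ∀ k, ∀ x y : P, x < y → r y - r x = k → ∃ z, x ≤ z ∧ z < y ∧ r y = r z + 1 := by
    intro k
    induction k using Nat.strong_induction_on with
    | _ k ih =>
    intro x y hxy hk
    have h1 := hr hxy
    by_cases h : r x + 2 ≤ r y
    · obtain ⟨z, hxz, hzy⟩ := hgap x y hxy h
      have h2 := hr hxz
      have h3 := hr hzy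
      obtain ⟨w, hw1, hw2, hw3⟩ := ih (r y - r z) (by omega) z y hzy rfl
      exact ⟨w, hxz.le.trans hw1, hw2, hw3⟩
    · exact ⟨x, le_rfl, hxy, by omega⟩
  have hheight : ∀ k, ∀ x : P, r x - r ⊥ = k → Order.height x = (k : ℕ∞) := by
    intro k
    induction k using Nat.strong_induction_on with
    | _ k ih =>
    intro x hk
    apply le_antisymm
    · rw [Order.height_le_coe_iff]
      intro y hy
      have h1 := hr hy
      have h2 := hbot y
      rw [ih (r y - r ⊥) (by omega) y rfl]
      exact_mod_cast (by omega)
    · rcases Nat.eq_zero_or_pos k with rfl | hk0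
      · simp
      · have hx : (⊥ : P) < x := by
          refine bot_lt_iff_ne_bot.2 ?_
          rintro rfl
          omega
        obtain ⟨z, -, hzx, hz⟩ := hcover _ ⊥ x hx rfl
        have h2 := hbot z
        have h3 := Order.height_add_one_le hzx
        rw [ih (r z - r ⊥) (by omega) z rfl] at h3
        refine le_trans ?_ h3
        exact_mod_cast (by omega)
  have h := hheight _ x rfl
  have h2 := hbot x
  simp only [rk, h, ENat.toNat_natCast]
  omega

/-- Realizes posets of different types inside one order, so that a common rank function and common
sums can be used. The offset `r (ι ⊥)` allows upper intervals, whose least element has positive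
ambient rank. -/
theorem abIndex_eq_intervalIndex [BoundedOrder P] (ι : P ↪o α) (F : Finset α)
    (hF : ∀ y, y ∈ F ↔ ∃ x, ι x = y) (r : α → ℕ) (hr : ∀ x, rk x + r (ι ⊥) = r (ι x)) :
    abIndex P = intervalIndex F r (ι ⊥) (ι ⊤) := by
  classical
  have : Finite P := by
    refine Finite.of_injective (fun x : P => (⟨ι x, (hF _).2 ⟨x, rfl⟩⟩ : F)) fun x y h => ?_
    exact ι.injective (congrArg Subtype.val h)
  have : Fintype P := Fintype.ofFinite P
  rw [abIndex, finsum_mem_eq_finite_toFinset_sum _ (Set.toFinite _), intervalIndex]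
  refine Finset.sum_bij (fun C _ => C.map ι.toEmbedding) ?_ ?_ ?_ ?_
  · intro C hC
    obtain ⟨h1, h2⟩ := (Set.Finite.mem_toFinset _).1 hC
    rw [mem_chainsBetween]
    constructor
    · intro y hy
      obtain ⟨x, hx, rfl⟩ := Finset.mem_map.1 hy
      exact mem_between.2 ⟨(hF _).2 ⟨x, rfl⟩, ι.lt_iff_lt.2 (h2 x hx).1, ι.lt_iff_lt.2 (h2 x hx).2⟩
    · intro y hy z hz hyz
      rw [Finset.mem_coe, Finset.mem_map] at hy hz
      obtain ⟨y, hy, rfl⟩ := hy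
      obtain ⟨z, hz, rfl⟩ := hz
      simpa using h1.total hy hz
  · intro C _ D _ h
    exact Finset.map_injective _ h
  · intro D hD
    obtain ⟨h1, h2⟩ := mem_chainsBetween.1 hD
    refine ⟨Finset.univ.filter fun x => ι x ∈ D, ?_, ?_⟩
    · rw [Set.Finite.mem_toFinset]
      constructor
      · intro x hx y hy _
        have hx' : ι x ∈ D := by simpa using hx
        have hy' : ι y ∈ D := by simpa using hy
        simpa using h2.total hx' hy'
      · intro x hx
        have hx' : ι x ∈ D := by simpa using hx
        obtain ⟨-, h3, h4⟩ := mem_between.1 (h1 hx')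
        exact ⟨ι.lt_iff_lt.1 h3, ι.lt_iff_lt.1 h4⟩
    · ext y
      simp only [Finset.mem_map, Finset.mem_filter, Finset.mem_univ, true_and]
      constructor
      · rintro ⟨x, hx, rfl⟩
        exact hx
      · intro hy
        obtain ⟨x, rfl⟩ := (hF y).1 (mem_between.1 (h1 hy)).1
        exact ⟨x, hy, rfl⟩
  · intro C hC
    rw [chainWeight, chainWord, List.range'_eq_map_range, List.map_map]
    have h := hr ⊤
    rw [show r (ι ⊤) - r (ι ⊥) - 1 = rk (⊤ : P) - 1 by omega]
    congr 1
    refine List.map_congr_left fun i _ => ?_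
    have : (∃ x ∈ C, rk x = i + 1) ↔ ∃ y ∈ C.map ι.toEmbedding, r y = r (ι ⊥) + 1 + i := by
      constructor
      · rintro ⟨x, hx, h⟩
        refine ⟨ι x, Finset.mem_map_of_mem _ hx, ?_⟩
        have := hr x
        omega
      · rintro ⟨y, hy, h⟩
        obtain ⟨x, hx, rfl⟩ := Finset.mem_map.1 hy
        refine ⟨x, hx, ?_⟩
        have h3 := hr x
        change r (ι x) = _ at h
        omega
    simp only [Function.comp, letterAt, this, eVar]

end AbIndex

/-! ### The algebraic induction. -/

section Recursion

variable {α : Type*} [PartialOrder α]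

open Classical in
/-- The algebraic core of the cutting formula: `k - q` and the right-hand side satisfy the same
recursion. -/
theorem cut_recursion (R U : Finset α) (r : α → ℕ) (n : ℕ) (hUR : U ⊆ R)
    (hU : ∀ u ∈ U, ∀ y ∈ R, u < y → y ∈ U)
    (hr : ∀ x ∈ R, ∀ y ∈ R, x < y → r x < r y) (hn : ∀ x ∈ R, r x < n)
    (h k q p : α → ABPoly) (J : α → α → ABPoly)
    (hh : ∀ x ∈ R, h x = eVar ^ (n - r x - 1) +
      ∑ y ∈ R with x < y, eVar ^ (r y - r x - 1) * bVar * h y)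
    (hJ : ∀ x ∈ R, ∀ u ∈ U, x < u → J x u = eVar ^ (r u - r x - 1) +
      ∑ y ∈ R with x < y ∧ y < u, eVar ^ (r y - r x - 1) * bVar * J y u)
    (hk : ∀ x ∈ R, k x = 2 * eVar ^ (n - r x) + 2 * (eVar ^ (n - r x - 1) * bVar) +
      ∑ y ∈ R with x < y, eVar ^ (r y - r x - 1) * bVar * k y +
      2 * ∑ u ∈ U with x ≤ u, eVar ^ (r u - r x) * bVar * h u + p x)
    (hp : ∀ u ∈ U, p u = 0)
    (hq : ∀ x ∈ R, x ∉ U → q x = eVar ^ (n - r x) +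
      ∑ y ∈ R with x < y ∧ y ∉ U, eVar ^ (r y - r x - 1) * bVar * q y +
      ∑ u ∈ U with x < u, eVar ^ (r u - r x) * bVar * h u + p x) :
    ∀ x ∈ R, x ∉ U → k x - q x = h x * cVar + ∑ u ∈ U with x < u, J x u * dVar * h u := by
  set D : α → ABPoly := fun x => ∑ u ∈ U with x < u, J x u * dVar * h u with hD
  -- the recursion for the sum over split faces
  have hDrec : ∀ x ∈ R, D x = ∑ u ∈ U with x < u, eVar ^ (r u - r x - 1) * dVar * h u +
      ∑ y ∈ R with x < y, eVar ^ (r y - r x - 1) * bVar * D y := by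
    intro x hx
    have h1 : D x = ∑ u ∈ U with x < u, eVar ^ (r u - r x - 1) * dVar * h u +
        ∑ u ∈ U with x < u, ∑ y ∈ R with x < y ∧ y < u,
          eVar ^ (r y - r x - 1) * bVar * (J y u * dVar * h u) := by
      rw [hD, ← Finset.sum_add_distrib]
      refine Finset.sum_congr rfl fun u hu => ?_
      obtain ⟨huU, hxu⟩ := Finset.mem_filter.1 hu
      rw [hJ x hx u huU hxu, add_mul, add_mul, Finset.sum_mul, Finset.sum_mul]
      simp only [mul_assoc]
    rw [h1]
    congr 1
    simp only [hD, Finset.mul_sum]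
    refine Finset.sum_comm' fun u y => ?_
    simp only [Finset.mem_filter]
    constructor
    · rintro ⟨⟨h1, h2⟩, h3, h4, h5⟩
      exact ⟨⟨h1, h5⟩, h3, h4⟩
    · rintro ⟨⟨h1, h2⟩, h3, h4⟩
      exact ⟨⟨h1, h4.trans h2⟩, h3, h4, h2⟩
  set G : α → ABPoly := fun x => h x * cVar + D x with hG
  have hebc : eVar * bVar + bVar * cVar = dVar := by
    simp only [eVar, cVar, dVar]; noncomm_ring
  have hGrec : ∀ x ∈ R, G x = eVar ^ (n - r x - 1) * cVar +
      ∑ u ∈ U with x < u, eVar ^ (r u - r x - 1) * dVar * h u +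
      ∑ y ∈ R with x < y, eVar ^ (r y - r x - 1) * bVar * G y := by
    intro x hx
    simp only [hG, mul_add, Finset.sum_add_distrib]
    rw [hDrec x hx]
    nth_rewrite 1 [hh x hx]
    rw [add_mul, Finset.sum_mul]
    simp only [mul_assoc]
    abel
  have hpow : ∀ x ∈ R, eVar ^ (n - r x) = eVar ^ (n - r x - 1) * eVar := by
    intro x hx
    have := hn x hx
    rw [← pow_succ]
    congr 1
    omega
  have hpow' : ∀ x ∈ R, ∀ u ∈ R, x < u → eVar ^ (r u - r x) = eVar ^ (r u - r x - 1) * eVar := by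
    intro x hx u hu hxu
    have := hr x hx u hu hxu
    rw [← pow_succ]
    congr 1
    omega
  -- the split faces
  have hsplit : ∀ m, ∀ x ∈ U, n - r x = m → k x = G x + cVar * h x := by
    intro m
    induction m using Nat.strong_induction_on with
    | _ m ih =>
    intro x hxU hm
    have hx := hUR hxU
    have hfilt : (R.filter fun y => x < y) = U.filter fun y => x < y := by
      ext y
      simp only [Finset.mem_filter]
      exact ⟨fun hy => ⟨hU x hxU y hy.1 hy.2, hy.2⟩, fun hy => ⟨hUR hy.1, hy.2⟩⟩
    have hle : (U.filter fun u => x ≤ u) = insert x (U.filter fun u => x < u) := by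
      ext y
      simp only [Finset.mem_filter, Finset.mem_insert, le_iff_eq_or_lt]
      constructor
      · rintro ⟨h1, rfl | h2⟩
        · exact Or.inl rfl
        · exact Or.inr ⟨h1, h2⟩
      · rintro (rfl | ⟨h1, h2⟩)
        · exact ⟨hxU, Or.inl rfl⟩
        · exact ⟨h1, Or.inr h2⟩
    have hkG : ∑ y ∈ R with x < y, eVar ^ (r y - r x - 1) * bVar * k y =
        ∑ y ∈ R with x < y, eVar ^ (r y - r x - 1) * bVar * G y +
        ∑ y ∈ U with x < y, eVar ^ (r y - r x - 1) * (bVar * cVar) * h y := by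
      rw [hfilt, ← Finset.sum_add_distrib]
      refine Finset.sum_congr rfl fun y hy => ?_
      obtain ⟨hyU, hxy⟩ := Finset.mem_filter.1 hy
      have h1 := hr x hx y (hUR hyU) hxy
      have h2 := hn y (hUR hyU)
      rw [ih (n - r y) (by omega) y hyU rfl]
      noncomm_ring
    have heh : eVar * h x = eVar ^ (n - r x) +
        ∑ u ∈ U with x < u, eVar ^ (r u - r x) * bVar * h u := by
      rw [hh x hx, mul_add, ← pow_succ', Finset.mul_sum, hfilt]
      congr 1
      · congr 1
        have := hn x hx
        omega
      · refine Finset.sum_congr rfl fun y hy => ?_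
        obtain ⟨hyU, hxy⟩ := Finset.mem_filter.1 hy
        rw [← mul_assoc, ← mul_assoc, ← pow_succ']
        congr 3
        have := hr x hx y (hUR hyU) hxy
        omega
    have hd : ∑ u ∈ U with x < u, eVar ^ (r u - r x - 1) * dVar * h u =
        ∑ u ∈ U with x < u, eVar ^ (r u - r x) * bVar * h u +
        ∑ y ∈ U with x < y, eVar ^ (r y - r x - 1) * (bVar * cVar) * h y := by
      rw [← Finset.sum_add_distrib]
      refine Finset.sum_congr rfl fun y hy => ?_
      obtain ⟨hyU, hxy⟩ := Finset.mem_filter.1 hy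
      rw [hpow' x hx y (hUR hyU) hxy, ← hebc]
      noncomm_ring
    rw [hk x hx, hp x hxU, add_zero, hle, Finset.sum_insert (by simp), hkG, hGrec x hx, hd,
      Nat.sub_self, pow_zero, one_mul]
    have h3 : cVar = eVar + 2 * bVar := by simp only [cVar, eVar]; noncomm_ring
    have h4 : cVar * h x = eVar * h x + 2 * bVar * h x := by rw [h3, add_mul]
    rw [h4, heh, hpow x hx, h3]
    noncomm_ring
  -- The terms of `k` at old faces are replaced by G + q by induction, those at new faces by G + c
  -- h. The q-terms and `p` cancel; eb + bc = d and e + 2b = c leave the recursion of `G`.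
  have hmain : ∀ m, ∀ x ∈ R, x ∉ U → n - r x = m → k x - q x = G x := by
    intro m
    induction m using Nat.strong_induction_on with
    | _ m ih =>
    intro x hx hxU hm
    have hle : (U.filter fun u => x ≤ u) = U.filter fun u => x < u := by
      ext y
      simp only [Finset.mem_filter, le_iff_eq_or_lt]
      constructor
      · rintro ⟨h1, rfl | h2⟩
        · exact absurd h1 hxU
        · exact ⟨h1, h2⟩
      · exact fun h => ⟨h.1, Or.inr h.2⟩
    have hsum : ∀ f : α → ABPoly, ∑ y ∈ R with x < y, f y =
        ∑ y ∈ R with x < y ∧ y ∉ U, f y + ∑ y ∈ U with x < y, f y := by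
      intro f
      rw [← Finset.sum_filter_not_add_sum_filter (R.filter fun y => x < y) (fun y => y ∈ U),
        Finset.filter_filter, Finset.filter_filter]
      congr 2
      ext y
      simp only [Finset.mem_filter]
      exact ⟨fun h => ⟨h.2.2, h.2.1⟩, fun h => ⟨hUR h.1, h.2, h.1⟩⟩
    have hN : ∑ y ∈ R with x < y ∧ y ∉ U, eVar ^ (r y - r x - 1) * bVar * k y =
        ∑ y ∈ R with x < y ∧ y ∉ U, eVar ^ (r y - r x - 1) * bVar * G y +
        ∑ y ∈ R with x < y ∧ y ∉ U, eVar ^ (r y - r x - 1) * bVar * q y := by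
      rw [← Finset.sum_add_distrib]
      refine Finset.sum_congr rfl fun y hy => ?_
      obtain ⟨hyR, hxy, hyU⟩ := Finset.mem_filter.1 hy
      have h1 := hr x hx y hyR hxy
      have h2 := hn y hyR
      rw [← ih (n - r y) (by omega) y hyR hyU rfl]
      noncomm_ring
    have hS : ∑ y ∈ U with x < y, eVar ^ (r y - r x - 1) * bVar * k y =
        ∑ y ∈ U with x < y, eVar ^ (r y - r x - 1) * bVar * G y +
        ∑ y ∈ U with x < y, eVar ^ (r y - r x - 1) * (bVar * cVar) * h y := by
      rw [← Finset.sum_add_distrib]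
      refine Finset.sum_congr rfl fun y hy => ?_
      rw [hsplit _ y (Finset.mem_filter.1 hy).1 rfl]
      noncomm_ring
    have hd : ∑ u ∈ U with x < u, eVar ^ (r u - r x - 1) * dVar * h u =
        ∑ u ∈ U with x < u, eVar ^ (r u - r x) * bVar * h u +
        ∑ y ∈ U with x < y, eVar ^ (r y - r x - 1) * (bVar * cVar) * h y := by
      rw [← Finset.sum_add_distrib]
      refine Finset.sum_congr rfl fun y hy => ?_
      obtain ⟨hyU, hxy⟩ := Finset.mem_filter.1 hy
      rw [hpow' x hx y (hUR hyU) hxy, ← hebc]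
      noncomm_ring
    rw [hk x hx, hq x hx hxU, hGrec x hx, hle, hsum, hsum, hN, hS, hd, hpow x hx]
    have h3 : cVar = eVar + 2 * bVar := by simp only [cVar, eVar]; noncomm_ring
    rw [h3]
    noncomm_ring
  exact fun x hx hxU => hmain _ x hx hxU rfl

end Recursion

/-! ### Faces of polytopes: finiteness and transitivity. -/

section Polytopes

variable {E : Type*} [NormedAddCommGroup E] [NormedSpace ℝ E]

theorem IsPolytope.convex {Q : Set E} (hQ : IsPolytope Q) : Convex ℝ Q := by
  obtain ⟨s, rfl⟩ := hQ
  exact convex_convexHull ℝ _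

theorem apply_le_of_mem_convexHull {s : Set E} {m : StrongDual ℝ E} {M : ℝ}
    (hm : ∀ v ∈ s, m v ≤ M) {x : E} (hx : x ∈ convexHull ℝ s) : m x ≤ M := by
  have h : convexHull ℝ s ⊆ {x | m x ≤ M} :=
    convexHull_min hm (convex_halfSpace_le m.toLinearMap.isLinear M)
  exact h hx

-- In a convex combination attaining the bound, the nonnegative numbers w(v)(M - m(v)) sum to zero,
-- so only points with m(v) = M carry weight.
open Classical in
theorem mem_convexHull_filter_of_apply_eq {s : Finset E} {m : StrongDual ℝ E} {M : ℝ}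
    (hm : ∀ v ∈ s, m v ≤ M) {x : E} (hx : x ∈ convexHull ℝ (s : Set E)) (hxM : m x = M) :
    x ∈ convexHull ℝ ((s.filter fun v => m v = M : Finset E) : Set E) := by
  obtain ⟨w, hw0, hw1, hwx⟩ := Finset.mem_convexHull'.1 hx
  have hsum : ∑ v ∈ s, w v * (M - m v) = 0 := by
    have : m x = ∑ v ∈ s, w v * m v := by
      rw [← hwx, map_sum]
      simp
    simp only [mul_sub, Finset.sum_sub_distrib, ← Finset.sum_mul, hw1]
    linarith
  have hzero := (Finset.sum_eq_zero_iff_of_nonneg fun v hv =>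
    mul_nonneg (hw0 v hv) (sub_nonneg.2 (hm v hv))).1 hsum
  have hne : ∀ v ∈ s, w v ≠ 0 → m v = M := by
    intro v hv hwv
    have := (mul_eq_zero.1 (hzero v hv)).resolve_left hwv
    linarith
  refine Finset.mem_convexHull'.2 ⟨w, fun v hv => hw0 v (Finset.mem_filter.1 hv).1, ?_, ?_⟩
  · rw [Finset.sum_filter_of_ne fun v hv h => hne v hv h, hw1]
  · rw [Finset.sum_filter_of_ne fun v hv h => hne v hv fun h0 => h (by rw [h0, zero_smul]), hwx]

theorem isExposed_setOf_eq {Q : Set E} {m : StrongDual ℝ E} {M : ℝ} (hm : ∀ x ∈ Q, m x ≤ M) :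
    IsExposed ℝ Q {x ∈ Q | m x = M} := by
  rintro ⟨z, hzQ, hz⟩
  refine ⟨m, Set.ext fun x => ⟨fun hx => ⟨hx.1, fun y hy => (hm y hy).trans hx.2.ge⟩, fun hx => ?_⟩⟩
  exact ⟨hx.1, le_antisymm (hm x hx.1) (hz ▸ hx.2 z hzQ)⟩

theorem exists_eq_setOf_of_isExposed {Q F : Set E} (hF : IsExposed ℝ Q F) (hne : F.Nonempty) :
    ∃ (m : StrongDual ℝ E) (M : ℝ), (∀ x ∈ Q, m x ≤ M) ∧ F = {x ∈ Q | m x = M} := by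
  obtain ⟨z, hz⟩ := hne
  obtain ⟨m, rfl⟩ := hF ⟨z, hz⟩
  refine ⟨m, m z, hz.2, Set.ext fun x => ⟨fun hx => ⟨hx.1, ?_⟩, fun hx => ⟨hx.1, fun y hy => ?_⟩⟩⟩
  · exact le_antisymm (hz.2 x hx.1) (hx.2 z hz.1)
  · exact (hz.2 y hy).trans hx.2.ge

-- A face is determined by the generators it contains; hence faces are polytopes and there are
-- finitely many.
open Classical in
theorem isExposed_eq_convexHull {s : Finset E} {F : Set E}
    (hF : IsExposed ℝ (convexHull ℝ (s : Set E)) F) :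
    F = convexHull ℝ ((s.filter fun v => v ∈ F : Finset E) : Set E) := by
  rcases F.eq_empty_or_nonempty with rfl | hne
  · simp
  apply Set.Subset.antisymm
  · obtain ⟨m, M, hm, hFeq⟩ := exists_eq_setOf_of_isExposed hF hne
    intro x hxF
    have hx := hxF
    rw [hFeq] at hx
    refine convexHull_mono ?_ (mem_convexHull_filter_of_apply_eq
      (fun v hv => hm v (subset_convexHull ℝ _ hv)) hx.1 hx.2)
    intro v hv
    rw [Finset.mem_coe, Finset.mem_filter] at hv
    rw [Finset.mem_coe, Finset.mem_filter, hFeq]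
    exact ⟨hv.1, subset_convexHull ℝ _ hv.1, hv.2⟩
  · refine convexHull_min ?_ (hF.convex (convex_convexHull ℝ _))
    intro v hv
    exact (Finset.mem_filter.1 hv).2

theorem IsPolytope.of_isExposed {Q F : Set E} (hQ : IsPolytope Q) (hF : IsExposed ℝ Q F) :
    IsPolytope F := by
  classical
  obtain ⟨s, rfl⟩ := hQ
  exact ⟨_, isExposed_eq_convexHull hF⟩

theorem IsPolytope.finite_isExposed {Q : Set E} (hQ : IsPolytope Q) :
    {F : Set E | IsExposed ℝ Q F}.Finite := by
  classical
  obtain ⟨s, rfl⟩ := hQ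
  refine (s.powerset.image fun u : Finset E => convexHull ℝ (u : Set E)).finite_toSet.subset ?_
  intro F hF
  rw [Finset.mem_coe, Finset.mem_image]
  exact ⟨_, Finset.mem_powerset.2 (Finset.filter_subset _ _), (isExposed_eq_convexHull hF).symm⟩

/-- A face of a face of a polytope is a face. -/
theorem IsPolytope.isExposed_trans {Q F G : Set E} (hQ : IsPolytope Q) (hF : IsExposed ℝ Q F)
    (hG : IsExposed ℝ F G) : IsExposed ℝ Q G := by
  classical
  rcases G.eq_empty_or_nonempty with rfl | hne
  · exact isExposed_empty
  obtain ⟨m, M, hm, hFeq⟩ := exists_eq_setOf_of_isExposed hF (hne.mono hG.subset)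
  obtain ⟨k, K, hk, hGeq⟩ := exists_eq_setOf_of_isExposed hG hne
  obtain ⟨s, rfl⟩ := hQ
  -- For large `N` the functional `N m + k` prefers `F` to every generator outside it and is
  -- maximized on `F` exactly along `G`. Finiteness of `s` makes one `N` suffice.
  have hev : ∀ᶠ N : ℝ in Filter.atTop, ∀ v ∈ s, m v < M → N * m v + k v < N * M + K := by
    rw [Filter.eventually_all_finset]
    intro v hv
    by_cases h : m v < M
    · filter_upwards [Filter.eventually_gt_atTop ((k v - K) / (M - m v))] with N hN _
      rw [div_lt_iff₀ (by linarith)] at hN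
      linarith
    · exact Filter.Eventually.of_forall fun N h' => absurd h' h
  obtain ⟨N, hN⟩ := hev.exists
  have hvert : ∀ v ∈ s, N * m v + k v ≤ N * M + K := by
    intro v hv
    have hvQ := subset_convexHull ℝ (s : Set E) hv
    rcases (hm v hvQ).lt_or_eq with h | h
    · exact (hN v hv h).le
    · have := hk v (by rw [hFeq]; exact ⟨hvQ, h⟩)
      rw [h]
      linarith
  have happ : ∀ x, (N • m + k) x = N * m x + k x := fun x => by simp
  have hle : ∀ x ∈ convexHull ℝ (s : Set E), (N • m + k) x ≤ N * M + K := fun x hx =>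
    apply_le_of_mem_convexHull (m := N • m + k) (fun v hv => by rw [happ]; exact hvert v hv) hx
  convert isExposed_setOf_eq hle using 1
  ext x
  constructor
  · intro hx
    have hxF := hG.subset hx
    have h1 : m x = M := by rw [hFeq] at hxF; exact hxF.2
    have h2 : k x = K := by rw [hGeq] at hx; exact hx.2
    exact ⟨hF.subset hxF, by rw [happ, h1, h2]⟩
  · rintro ⟨hxQ, hx⟩
    have hmem := mem_convexHull_filter_of_apply_eq (s := s) (m := N • m + k)
      (fun v hv => by rw [happ]; exact hvert v hv) hxQ hx
    have hmx : m x = M := by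
      refine le_antisymm (hm x hxQ) ?_
      have := apply_le_of_mem_convexHull (m := -m) (M := -M) ?_ hmem
      · simpa using this
      · intro v hv
        rw [Finset.mem_coe, Finset.mem_filter, happ] at hv
        have hvQ := subset_convexHull ℝ (s : Set E) hv.1
        rcases (hm v hvQ).lt_or_eq with h | h
        · exact absurd hv.2 (hN v hv.1 h).ne
        · simp [h]
    rw [hGeq, hFeq]
    refine ⟨⟨hxQ, hmx⟩, ?_⟩
    rw [happ, hmx] at hx
    linarith

theorem IsExposed.mem_of_openSegment {Q F : Set E} (hF : IsExposed ℝ Q F) {x y z : E}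
    (hx : x ∈ Q) (hy : y ∈ Q) (hz : z ∈ F) (hzs : z ∈ openSegment ℝ x y) : x ∈ F :=
  hF.isExtreme.left_mem_of_mem_openSegment hx hy hz hzs

end Polytopes

/-! ### The face poset is graded by dimension plus one. -/

section DimRank

variable {E : Type*} [NormedAddCommGroup E] [NormedSpace ℝ E]

open Classical in
/-- One more than the dimension of the affine span; zero for the empty set. -/
noncomputable def dimRank (F : Set E) : ℕ :=
  if F = ∅ then 0 else Module.finrank ℝ (vectorSpan ℝ F) + 1

theorem dimRank_empty : dimRank (∅ : Set E) = 0 := if_pos rfl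

theorem dimRank_of_nonempty {F : Set E} (hF : F.Nonempty) :
    dimRank F = Module.finrank ℝ (vectorSpan ℝ F) + 1 := if_neg hF.ne_empty

theorem vectorSpan_le_ker {F : Set E} {m : StrongDual ℝ E} {M : ℝ} (h : ∀ x ∈ F, m x = M) :
    vectorSpan ℝ F ≤ LinearMap.ker m.toLinearMap := by
  rw [vectorSpan_def, Submodule.span_le]
  rintro _ ⟨x, hx, y, hy, rfl⟩
  simp [h x hx, h y hy]

/-- Rotate the supporting hyperplane of `F` about `F`, tilting `m` towards `k`, until it hits
another generator. The direction `w` certifies that the tilted functional is not constant on `Q`, so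
the new face is proper. -/
theorem exists_isExposed_between_of_functionals {Q F : Set E} (hQ : IsPolytope Q)
    {m k : StrongDual ℝ E} {M K : ℝ} (hm : ∀ x ∈ Q, m x ≤ M) (hF : F = {x ∈ Q | m x = M})
    (hk : ∀ x ∈ F, k x = K) {w : E} (hwQ : w ∈ vectorSpan ℝ Q) (hmw : m w = 0) (hkw : k w ≠ 0)
    {x : E} (hx : x ∈ Q) (hkx : K < k x) :
    ∃ G, IsExposed ℝ Q G ∧ F ⊂ G ∧ G ⊂ Q := by
  classical
  obtain ⟨s, rfl⟩ := hQ
  have hmem : ∀ v ∈ s, v ∈ convexHull ℝ (s : Set E) := fun v hv => subset_convexHull ℝ _ hv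
  have hnonempty : (s.filter fun v => K < k v).Nonempty := by
    by_contra h
    rw [Finset.not_nonempty_iff_eq_empty, Finset.filter_eq_empty_iff] at h
    exact absurd (apply_le_of_mem_convexHull (fun v hv => not_lt.1 (h hv)) hx) (not_le.2 hkx)
  -- The least ratio is the first tilt at which a generator outside `F` becomes a maximizer.
  obtain ⟨v₀, hv₀, hmin⟩ :=
    (s.filter fun v => K < k v).exists_min_image (fun v => (M - m v) / (k v - K)) hnonempty
  rw [Finset.mem_filter] at hv₀
  have hv₀F : v₀ ∉ F := fun h => hv₀.2.ne' (hk v₀ h)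
  have hmv₀ : m v₀ < M := lt_of_le_of_ne (hm v₀ (hmem v₀ hv₀.1)) fun h =>
    hv₀F (by rw [hF]; exact ⟨hmem v₀ hv₀.1, h⟩)
  set c := (M - m v₀) / (k v₀ - K) with hc
  have hcpos : 0 < c := div_pos (by linarith) (by linarith)
  have happ : ∀ y, (m + c • k) y = m y + c * k y := fun y => by simp
  have hvert : ∀ v ∈ s, (m + c • k) v ≤ M + c * K := by
    intro v hv
    rw [happ]
    by_cases h : K < k v
    · have := hmin v (Finset.mem_filter.2 ⟨hv, h⟩)
      rw [le_div_iff₀ (by linarith)] at this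
      linarith
    · have h1 := hm v (hmem v hv)
      have h2 := mul_le_mul_of_nonneg_left (not_lt.1 h) hcpos.le
      linarith
  have hle : ∀ y ∈ convexHull ℝ (s : Set E), (m + c • k) y ≤ M + c * K :=
    fun y hy => apply_le_of_mem_convexHull hvert hy
  refine ⟨_, isExposed_setOf_eq hle, ?_, ?_⟩
  · refine ⟨fun y hy => ?_, fun hsub => hv₀F (hsub ⟨hmem v₀ hv₀.1, ?_⟩)⟩
    · have hy' := hy
      rw [hF] at hy'
      exact ⟨hy'.1, by rw [happ, hy'.2, hk y hy]⟩
    · have h1 : c * (k v₀ - K) = M - m v₀ := div_mul_cancel₀ _ (by linarith)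
      rw [happ]
      linarith
  · refine ⟨fun y hy => hy.1, fun hsub => ?_⟩
    have h1 := vectorSpan_le_ker (m := m + c • k) (fun y hy => (hsub hy).2) hwQ
    have h2 : (m + c • k) w = 0 := h1
    rw [happ, hmw, zero_add] at h2
    exact (mul_ne_zero hcpos.ne' hkw) h2

open Classical in
/-- The set of faces of a polytope; by convention empty for a set with infinitely many faces. -/
noncomputable def faces (Q : Set E) : Finset (Set E) :=
  if h : {F : Set E | IsExposed ℝ Q F}.Finite then h.toFinset else ∅

theorem IsPolytope.mem_faces {Q F : Set E} (hQ : IsPolytope Q) :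
    F ∈ faces Q ↔ IsExposed ℝ Q F := by
  simp [faces, hQ.finite_isExposed]

variable [FiniteDimensional ℝ E]

/-- A functional exposing a nonempty `F` is constant on its affine span, so a point of `Q` in that
span already lies in `F`. -/
theorem dimRank_lt {Q F G : Set E} (hF : IsExposed ℝ Q F) (hG : G ⊆ Q) (h : F ⊂ G) :
    dimRank F < dimRank G := by
  obtain ⟨x, hxG, hxF⟩ := Set.exists_of_ssubset h
  rw [dimRank_of_nonempty ⟨x, hxG⟩]
  rcases F.eq_empty_or_nonempty with rfl | hne
  · rw [dimRank_empty]; omega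
  rw [dimRank_of_nonempty hne]
  obtain ⟨m, M, hm, hFeq⟩ := exists_eq_setOf_of_isExposed hF hne
  have hlt : vectorSpan ℝ F < vectorSpan ℝ G := by
    refine lt_of_le_of_ne (vectorSpan_mono ℝ h.subset) fun heq => ?_
    obtain ⟨z, hz⟩ := hne
    have h1 : x - z ∈ vectorSpan ℝ F := by
      rw [heq]; exact vsub_mem_vectorSpan ℝ hxG (h.subset hz)
    have h2 := vectorSpan_le_ker (m := m) (M := M) (fun y hy => by rw [hFeq] at hy; exact hy.2) h1
    have h3 : m z = M := by rw [hFeq] at hz; exact hz.2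
    have h4 : m x = M := by
      have : m (x - z) = 0 := h2
      rw [map_sub] at this
      linarith
    exact hxF (by rw [hFeq]; exact ⟨hG hxG, h4⟩)
  have := Submodule.finrank_lt_finrank_of_lt hlt
  omega

theorem IsPolytope.exists_isExposed_between_top {Q F : Set E} (hQ : IsPolytope Q)
    (hF : IsExposed ℝ Q F) (hdim : dimRank F + 2 ≤ dimRank Q) :
    ∃ G, IsExposed ℝ Q G ∧ F ⊂ G ∧ G ⊂ Q := by
  have hQne : Q.Nonempty := by
    rw [Set.nonempty_iff_ne_empty]
    rintro rfl
    rw [dimRank_empty] at hdim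
    omega
  obtain ⟨m, M, hm, V, hV, hVQ, hFV, hVdim, hFeq⟩ : ∃ (m : StrongDual ℝ E) (M : ℝ),
      (∀ x ∈ Q, m x ≤ M) ∧ ∃ V : Submodule ℝ E, V ≤ LinearMap.ker m.toLinearMap ∧
        V ≤ vectorSpan ℝ Q ∧ vectorSpan ℝ F ≤ V ∧
        Module.finrank ℝ (vectorSpan ℝ F) < Module.finrank ℝ V ∧ F = {x ∈ Q | m x = M} := by
    rcases F.eq_empty_or_nonempty with rfl | hne
    -- The empty face is where the zero functional attains the unattained bound 1.
    · refine ⟨0, 1, fun x _ => by simp, vectorSpan ℝ Q, by simp, le_rfl, by simp, ?_, by simp⟩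
      rw [dimRank_empty, dimRank_of_nonempty hQne] at hdim
      rw [vectorSpan_empty, finrank_bot]
      omega
    · obtain ⟨m, M, hm, hFeq⟩ := exists_eq_setOf_of_isExposed hF hne
      refine ⟨m, M, hm, vectorSpan ℝ Q ⊓ LinearMap.ker m.toLinearMap, inf_le_right, inf_le_left,
        le_inf (vectorSpan_mono ℝ hF.subset)
          (vectorSpan_le_ker fun x hx => by rw [hFeq] at hx; exact hx.2), ?_, hFeq⟩
      rw [dimRank_of_nonempty hne, dimRank_of_nonempty hQne] at hdim
      have h1 := Submodule.finrank_sup_add_finrank_inf_eq (vectorSpan ℝ Q)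
        (LinearMap.ker m.toLinearMap)
      have h2 := LinearMap.finrank_range_add_finrank_ker m.toLinearMap
      have h3 := Submodule.finrank_le (vectorSpan ℝ Q ⊔ LinearMap.ker m.toLinearMap)
      have h4 := Submodule.finrank_le (LinearMap.range m.toLinearMap)
      rw [Module.finrank_self] at h4
      omega
  -- A direction in which `m` is constant but `F` does not extend; a functional `k` killing the
  -- directions of `F` but not `w` gives the tilt.
  obtain ⟨w, hwV, hwF⟩ : ∃ w ∈ V, w ∉ vectorSpan ℝ F := by
    by_contra! h
    exact absurd (Submodule.finrank_mono h) (not_le.2 hVdim)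
  obtain ⟨k₀, hk₀w, hk₀⟩ := Submodule.exists_le_ker_of_notMem hwF
  have hwQ := hVQ hwV
  have hmw : m w = 0 := hV hwV
  set k : StrongDual ℝ E := LinearMap.toContinuousLinearMap k₀ with hkdef
  have hkw : k w ≠ 0 := hk₀w
  have hconst : ∀ x ∈ F, ∀ y ∈ F, k x = k y := by
    intro x hx y hy
    have h1 : k₀ (x - y) = 0 := hk₀ (vsub_mem_vectorSpan ℝ hx hy)
    rw [map_sub, sub_eq_zero] at h1
    exact h1
  obtain ⟨x₀, hx₀, hx₀F⟩ : ∃ x₀ ∈ Q, F.Nonempty → x₀ ∈ F := by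
    rcases F.eq_empty_or_nonempty with rfl | ⟨z, hz⟩
    · obtain ⟨z, hz⟩ := hQne
      exact ⟨z, hz, fun h => absurd h Set.not_nonempty_empty⟩
    · exact ⟨z, hF.subset hz, fun _ => hz⟩
  obtain ⟨x, hx, hxne⟩ : ∃ x ∈ Q, k x ≠ k x₀ := by
    by_contra! h
    exact hkw (vectorSpan_le_ker h hwQ)
  rcases hxne.lt_or_gt with h | h
  · refine exists_isExposed_between_of_functionals hQ (k := -k) (K := -k x₀) hm hFeq
      (fun y hy => ?_) hwQ hmw (by simpa using hkw) hx (by simpa using h)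
    simp [hconst y hy x₀ (hx₀F ⟨y, hy⟩)]
  · exact exists_isExposed_between_of_functionals hQ (k := k) (K := k x₀) hm hFeq
      (fun y hy => hconst y hy x₀ (hx₀F ⟨y, hy⟩)) hwQ hmw hkw hx h

theorem IsPolytope.exists_isExposed_between {Q F G : Set E} (hQ : IsPolytope Q)
    (hF : IsExposed ℝ Q F) (hG : IsExposed ℝ Q G) (hFG : F ⊂ G)
    (hdim : dimRank F + 2 ≤ dimRank G) : ∃ D, IsExposed ℝ Q D ∧ F ⊂ D ∧ D ⊂ G := by
  obtain ⟨D, hD, h1, h2⟩ := (hQ.of_isExposed hG).exists_isExposed_between_top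
    (hF.mono hG.subset hFG.subset) hdim
  exact ⟨D, hQ.isExposed_trans hG hD, h1, h2⟩

theorem IsPolytope.dimRank_lt_of_mem_faces {Q : Set E} (hQ : IsPolytope Q) :
    ∀ F ∈ faces Q, ∀ G ∈ faces Q, F < G → dimRank F < dimRank G :=
  fun _ hF _ hG h => dimRank_lt (hQ.mem_faces.1 hF) (hQ.mem_faces.1 hG).subset h

theorem IsPolytope.psi_eq {Q : Set E} (hQ : IsPolytope Q) :
    Psi Q = intervalIndex (faces Q) dimRank ∅ Q := by
  let ι : FacePoset Q ↪o Set E := OrderEmbedding.subtype _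
  have hbot : ι ⊥ = ∅ := rfl
  have htop : ι ⊤ = Q := rfl
  rw [Psi, abIndex_eq_intervalIndex ι (faces Q) (fun F => ?_) dimRank ?_, hbot, htop]
  swap
  · rw [hQ.mem_faces]
    exact ⟨fun h => ⟨⟨F, h⟩, rfl⟩, fun ⟨x, hx⟩ => hx ▸ x.2⟩
  · refine rk_add_eq_of_graded (fun F : FacePoset Q => dimRank F.1) ?_ ?_
    · intro F G h
      exact dimRank_lt F.2 G.2.subset h
    · intro F G h hd
      obtain ⟨D, hD, h1, h2⟩ := hQ.exists_isExposed_between F.2 G.2 h hd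
      exact ⟨⟨D, hD⟩, h1, h2⟩

theorem IsPolytope.psiFaceFigure_eq {Q : Set E} (hQ : IsPolytope Q) (F : FacePoset Q) :
    PsiFaceFigure F = intervalIndex (faces Q) dimRank F.1 Q := by
  classical
  have h : PsiFaceFigure F =
      intervalIndex ((faces Q).filter fun G => F.1 ≤ G) dimRank F.1 Q := by
    let ι : Set.Ici F ↪o Set E :=
      (OrderEmbedding.subtype (· ∈ Set.Ici F)).trans (OrderEmbedding.subtype _)
    have hbot : ι ⊥ = F.1 := rfl
    have htop : ι ⊤ = Q := rfl
    rw [PsiFaceFigure, abIndex_eq_intervalIndex ι ((faces Q).filter fun G => F.1 ≤ G)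
      (fun G => ?_) dimRank ?_, hbot, htop]
    swap
    · rw [Finset.mem_filter, hQ.mem_faces]
      exact ⟨fun h => ⟨⟨⟨G, h.1⟩, h.2⟩, rfl⟩, fun ⟨x, hx⟩ => hx ▸ ⟨x.1.2, x.2⟩⟩
    · refine rk_add_eq_of_graded (fun G : Set.Ici F => dimRank G.1.1) ?_ ?_
      · intro G G' h
        exact dimRank_lt G.1.2 G'.1.2.subset h
      · intro G G' h hd
        obtain ⟨D, hD, h1, h2⟩ := hQ.exists_isExposed_between G.1.2 G'.1.2 h hd
        exact ⟨⟨⟨D, hD⟩, le_trans (show F.1 ≤ G.1.1 from G.2) h1.le⟩, h1, h2⟩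
  rw [h]
  apply intervalIndex_congr
  ext G
  simp only [mem_between, Finset.mem_filter]
  exact ⟨fun h => ⟨h.1.1, h.2⟩, fun h => ⟨⟨h.1, h.2.1.le⟩, h.2⟩⟩

theorem IsPolytope.psi_face_eq {Q F : Set E} (hQ : IsPolytope Q) (hF : IsExposed ℝ Q F) :
    Psi F = intervalIndex (faces Q) dimRank ∅ F := by
  rw [(hQ.of_isExposed hF).psi_eq]
  apply intervalIndex_congr
  ext G
  simp only [mem_between, hQ.mem_faces, (hQ.of_isExposed hF).mem_faces]
  exact ⟨fun h => ⟨hQ.isExposed_trans hF h.1, h.2⟩,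
    fun h => ⟨h.1.mono hF.subset h.2.2.le, h.2⟩⟩

end DimRank

/-! ### Cutting a polytope by a hyperplane. -/

section Halfspaces

variable {E : Type*} [NormedAddCommGroup E] [NormedSpace ℝ E] {l : StrongDual ℝ E} {t : ℝ}

theorem exists_mem_openSegment_hyperplane {p q : E} (hp : t < l p) (hq : l q < t) :
    ∃ z ∈ openSegment ℝ p q, l z = t := by
  have h : 0 < l p - l q := by linarith
  refine ⟨((t - l q) / (l p - l q)) • p + ((l p - t) / (l p - l q)) • q,
    ⟨_, _, div_pos (by linarith) h, div_pos (by linarith) h, ?_, rfl⟩, ?_⟩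
  · rw [← add_div, div_eq_one_iff_eq h.ne']
    ring
  · simp only [map_add, map_smul, smul_eq_mul]
    field_simp
    ring

theorem exists_mem_openSegment_upperHalf {p : E} (hp : t < l p) (q : E) :
    ∃ z ∈ openSegment ℝ p q, t ≤ l z := by
  rcases lt_or_ge (l q) t with hq | hq
  · obtain ⟨z, hz, hzt⟩ := exists_mem_openSegment_hyperplane hp hq
    exact ⟨z, hz, hzt.ge⟩
  · refine ⟨(1 / 2 : ℝ) • p + (1 / 2 : ℝ) • q,
      ⟨_, _, by norm_num, by norm_num, by norm_num, rfl⟩, ?_⟩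
    simp only [map_add, map_smul, smul_eq_mul]
    linarith

/-- A functional bounded on the section of a polytope by a hyperplane can be tilted to one that is
bounded on the vertices of the polytope. -/
theorem exists_tilt {s : Finset E} {m : StrongDual ℝ E} {M : ℝ} (hB : ∃ v ∈ s, l v < t)
    (heq : ∀ v ∈ s, l v = t → m v ≤ M)
    (hcross : ∀ u ∈ s, ∀ v ∈ s, t < l u → l v < t → ∃ z ∈ openSegment ℝ u v, l z = t ∧ m z ≤ M) :
    ∃ c : ℝ, ∀ v ∈ s, m v + c * (l v - t) ≤ M := by
  classical
  obtain ⟨v₁, hv₁, hlv₁⟩ := hB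
  -- The maximal ratio is the least `c` that works for all generators below; for a generator above,
  -- the crossing point on its segment to `v₀` gives the inequality.
  obtain ⟨v₀, hv₀, hmax⟩ := (s.filter fun v => l v < t).exists_max_image
    (fun v => (m v - M) / (t - l v)) ⟨v₁, Finset.mem_filter.2 ⟨hv₁, hlv₁⟩⟩
  rw [Finset.mem_filter] at hv₀
  refine ⟨(m v₀ - M) / (t - l v₀), fun v hv => ?_⟩
  rcases lt_trichotomy (l v) t with h | h | h
  · have := hmax v (Finset.mem_filter.2 ⟨hv, h⟩)
    rw [div_le_iff₀ (by linarith)] at this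
    linarith
  · have := heq v hv h
    rw [h]
    linarith
  · obtain ⟨z, ⟨a, b, ha, hb, hab, rfl⟩, hz, hmz⟩ := hcross v hv v₀ hv₀.1 h hv₀.2
    simp only [map_add, map_smul, smul_eq_mul] at hz hmz
    obtain rfl : a = 1 - b := by linarith
    have h1 : (1 - b) * (l v - t) = b * (t - l v₀) := by linarith
    have h2 : (1 - b) * (m v - M) + b * (m v₀ - M) ≤ 0 := by linarith
    have h3 : (m v₀ - M) / (t - l v₀) * (t - l v₀) = m v₀ - M :=
      div_mul_cancel₀ _ (by linarith)
    set c := (m v₀ - M) / (t - l v₀)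
    have h4 : (1 - b) * (m v - M + c * (l v - t)) ≤ 0 := by
      calc (1 - b) * (m v - M + c * (l v - t))
          = (1 - b) * (m v - M) + c * ((1 - b) * (l v - t)) := by ring
        _ = (1 - b) * (m v - M) + b * (c * (t - l v₀)) := by rw [h1]; ring
        _ ≤ 0 := by rw [h3]; exact h2
    have := nonpos_of_mul_nonpos_right h4 ha
    linarith

theorem convex_upperHalf : Convex ℝ (upperHalf l t) :=
  convex_halfSpace_ge l.toLinearMap.isLinear t

theorem IsPolytope.inter_upperHalf {Q : Set E} (hQ : IsPolytope Q) (l : StrongDual ℝ E) (t : ℝ) :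
    IsPolytope (Q ∩ upperHalf l t) := by
  classical
  obtain ⟨s, rfl⟩ := hQ
  have hcr : ∀ p : E × E, ∃ z, t < l p.1 → l p.2 < t → z ∈ openSegment ℝ p.1 p.2 ∧ l z = t := by
    intro p
    by_cases h : t < l p.1 ∧ l p.2 < t
    · obtain ⟨z, hz⟩ := exists_mem_openSegment_hyperplane h.1 h.2
      exact ⟨z, fun _ _ => hz⟩
    · exact ⟨0, fun h1 h2 => absurd ⟨h1, h2⟩ h⟩
  choose cross hcross using hcr
  -- Generators of the upper part: those of `Q` not below the hyperplane, and one crossing point for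
  -- each pair on opposite sides.
  set T : Finset E := (s.filter fun v => t ≤ l v) ∪
    ((s.filter fun v => t < l v) ×ˢ (s.filter fun v => l v < t)).image cross with hT
  refine ⟨T, Set.Subset.antisymm ?_ (convexHull_min ?_ ((convex_convexHull ℝ _).inter
    convex_upperHalf))⟩
  · rintro x ⟨hxs, hxt⟩
    by_contra hxT
    obtain ⟨m, M, hm, hxM⟩ := geometric_hahn_banach_closed_point (convex_convexHull ℝ (T : Set E))
      (T.finite_toSet.isCompact_convexHull ℝ).isClosed hxT
    have hmT : ∀ v ∈ T, m v ≤ M := fun v hv => (hm v (subset_convexHull ℝ _ hv)).le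
    have hmA : ∀ v ∈ s, t ≤ l v → m v ≤ M := fun v hv h =>
      hmT v (Finset.mem_union_left _ (Finset.mem_filter.2 ⟨hv, h⟩))
    by_cases hB : ∃ v ∈ s, l v < t
    · obtain ⟨c, hc⟩ := exists_tilt (m := m) (M := M) hB (fun v hv h => hmA v hv h.ge)
        (fun u hu v hv hut hvt => ⟨cross (u, v), (hcross (u, v) hut hvt).1,
          (hcross (u, v) hut hvt).2, hmT _ (Finset.mem_union_right _ (Finset.mem_image_of_mem _
            (Finset.mem_product.2 ⟨Finset.mem_filter.2 ⟨hu, hut⟩,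
              Finset.mem_filter.2 ⟨hv, hvt⟩⟩)))⟩)
      -- The tilt must be nonnegative for the bound to pass to `m x`, since `l x ≥ t`. If `c` is
      -- negative, then `m` itself is already bounded on all generators.
      have hc' : ∀ v ∈ s, m v + max c 0 * (l v - t) ≤ M := by
        intro v hv
        rcases max_cases c 0 with ⟨h, _⟩ | ⟨h, hc0⟩
        · rw [h]; exact hc v hv
        · rw [h, zero_mul, add_zero]
          rcases le_or_gt t (l v) with hvt | hvt
          · exact hmA v hv hvt
          · have h1 := hc v hv
            have h2 := mul_pos_of_neg_of_neg hc0 (show l v - t < 0 by linarith)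
            linarith
      have h1 := apply_le_of_mem_convexHull (m := m + max c 0 • l) (M := M + max c 0 * t)
        (fun v hv => by
          have := hc' v hv
          simp only [add_apply, smul_apply, smul_eq_mul]
          linarith) hxs
      simp only [add_apply, smul_apply, smul_eq_mul] at h1
      have h2 : 0 ≤ max c 0 * (l x - t) := mul_nonneg (le_max_right _ _) (sub_nonneg.2 hxt)
      linarith
    · push Not at hB
      exact absurd (apply_le_of_mem_convexHull (fun v hv => hmA v hv (hB v hv)) hxs) (not_le.2 hxM)
  · intro v hv
    rw [Finset.mem_coe, hT, Finset.mem_union] at hv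
    rcases hv with hv | hv
    · rw [Finset.mem_filter] at hv
      exact ⟨subset_convexHull ℝ _ hv.1, hv.2⟩
    · rw [Finset.mem_image] at hv
      obtain ⟨⟨u, w⟩, huw, rfl⟩ := hv
      simp only [Finset.mem_product, Finset.mem_filter] at huw
      obtain ⟨h1, h2⟩ := hcross (u, w) huw.1.2 huw.2.2
      exact ⟨(convex_convexHull ℝ _).openSegment_subset (subset_convexHull ℝ _ huw.1.1)
        (subset_convexHull ℝ _ huw.2.1) h1, h2.ge⟩

theorem lowerHalf_eq_upperHalf_neg (l : StrongDual ℝ E) (t : ℝ) :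
    lowerHalf l t = upperHalf (-l) (-t) := by
  ext x
  simp [lowerHalf, upperHalf]

theorem hyperplane_neg (l : StrongDual ℝ E) (t : ℝ) :
    hyperplane (-l) (-t) = hyperplane l t := by
  ext x
  simp [hyperplane]

theorem isExposed_inter_hyperplane_upperHalf (Q : Set E) :
    IsExposed ℝ (Q ∩ upperHalf l t) (Q ∩ hyperplane l t) := by
  have h := isExposed_setOf_eq (Q := Q ∩ upperHalf l t) (m := -l) (M := -t) fun x hx => by
    simpa using (show t ≤ l x from hx.2)
  convert h using 1
  ext x
  simp only [hyperplane, upperHalf, Set.mem_inter_iff, Set.mem_ofPred_eq, neg_apply, neg_inj]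
  exact ⟨fun h => ⟨⟨h.1, h.2.ge⟩, h.2⟩, fun h => ⟨h.1.1, h.2⟩⟩

theorem IsPolytope.inter_hyperplane {Q : Set E} (hQ : IsPolytope Q) (l : StrongDual ℝ E) (t : ℝ) :
    IsPolytope (Q ∩ hyperplane l t) :=
  (hQ.inter_upperHalf l t).of_isExposed (isExposed_inter_hyperplane_upperHalf Q)

/-- The set `F` meets both open halfspaces. -/
def Splits (l : StrongDual ℝ E) (t : ℝ) (F : Set E) : Prop :=
  (∃ x ∈ F, t < l x) ∧ ∃ x ∈ F, l x < t

theorem splits_neg {F : Set E} : Splits (-l) (-t) F ↔ Splits l t F := by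
  simp [Splits, and_comm]

theorem Splits.mono {F G : Set E} (hF : Splits l t F) (h : F ⊆ G) : Splits l t G :=
  ⟨hF.1.imp fun _ hx => ⟨h hx.1, hx.2⟩, hF.2.imp fun _ hx => ⟨h hx.1, hx.2⟩⟩

/-- From a point of `Q` off the hyperplane, the segment to a relative interior point on it can be
prolonged inside `Q` to the other side. -/
theorem splits_of_mem_intrinsicInterior {Q : Set E}
    (hmeet : (hyperplane l t ∩ intrinsicInterior ℝ Q).Nonempty)
    (hsplit : ¬ Q ⊆ hyperplane l t) : Splits l t Q := by
  obtain ⟨z, hzt, hz⟩ := hmeet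
  obtain ⟨q, hq, hqt⟩ := Set.not_subset.1 hsplit
  have hzt : l z = t := hzt
  have hqt : l q ≠ t := hqt
  obtain ⟨⟨z, hzQ⟩, hz', rfl⟩ := mem_intrinsicInterior.1 hz
  -- a point beyond `z` on the line from `q`
  obtain ⟨c, hc, hcQ⟩ : ∃ c : ℝ, 0 < c ∧ z + c • (z - q) ∈ Q := by
    have hqA : q ∈ affineSpan ℝ Q := subset_affineSpan ℝ Q hq
    have hmem : ∀ c : ℝ, z + c • (z - q) ∈ affineSpan ℝ Q := by
      intro c
      have := AffineMap.lineMap_mem (Q := affineSpan ℝ Q) (-c) hzQ hqA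
      rw [AffineMap.lineMap_apply_module'] at this
      convert this using 1
      module
    let f : ℝ → affineSpan ℝ Q := fun c => ⟨z + c • (z - q), hmem c⟩
    have hf : Continuous f := by
      apply Continuous.subtype_mk
      fun_prop
    have h0 : f 0 = ⟨z, hzQ⟩ := Subtype.ext (by simp [f])
    have hnhds : f ⁻¹' interior ((↑) ⁻¹' Q) ∈ nhds (0 : ℝ) :=
      (isOpen_interior.preimage hf).mem_nhds (by rw [Set.mem_preimage, h0]; exact hz')
    obtain ⟨ε, hε, hball⟩ := Metric.mem_nhds_iff.1 hnhds
    refine ⟨ε / 2, by linarith, ?_⟩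
    have : ε / 2 ∈ Metric.ball (0 : ℝ) ε := by
      rw [Metric.mem_ball, Real.dist_eq, sub_zero, abs_of_pos (by linarith)]
      linarith
    have hmem' : f (ε / 2) ∈ ((↑) ⁻¹' Q : Set (affineSpan ℝ Q)) := interior_subset (hball this)
    exact hmem'
  have hval : l (z + c • (z - q)) = t + c * (t - l q) := by
    have : l z = t := hzt
    simp [this]
  rcases hqt.lt_or_gt with h | h
  · refine ⟨⟨_, hcQ, ?_⟩, q, hq, h⟩
    rw [hval]
    have := mul_pos hc (sub_pos.2 h)
    linarith
  · refine ⟨⟨q, hq, h⟩, _, hcQ, ?_⟩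
    rw [hval]
    have := mul_pos hc (sub_pos.2 h)
    linarith

theorem Splits.nonempty_inter {F : Set E} (hF : Splits l t F) (hc : Convex ℝ F) :
    (F ∩ hyperplane l t).Nonempty := by
  obtain ⟨⟨p, hp, hpt⟩, q, hq, hqt⟩ := hF
  obtain ⟨z, hz, hzt⟩ := exists_mem_openSegment_hyperplane hpt hqt
  exact ⟨z, hc.openSegment_subset hp hq hz, hzt⟩

/-- Each point of `F` is an end of a segment in `F` having an inner point in the upper half, hence
in `G`; and `G` is extreme. -/
theorem subset_of_inter_upperHalf_subset {Q F G : Set E} (hFc : Convex ℝ F)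
    (hG : IsExposed ℝ Q G) (hF : F ⊆ Q) (hne : ∃ x ∈ F, t < l x)
    (h : F ∩ upperHalf l t ⊆ G) : F ⊆ G := by
  intro q hq
  obtain ⟨p, hp, hpt⟩ := hne
  obtain ⟨z, hz, hzt⟩ := exists_mem_openSegment_upperHalf hpt q
  have hzF := hFc.openSegment_subset hp hq hz
  rw [openSegment_symm] at hz
  exact IsExposed.mem_of_openSegment hG (hF hq) (hF hp) (h ⟨hzF, hzt⟩) hz

theorem subset_of_inter_hyperplane_subset {Q F G : Set E} (hFc : Convex ℝ F)
    (hG : IsExposed ℝ Q G) (hF : F ⊆ Q) (hs : Splits l t F)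
    (h : F ∩ hyperplane l t ⊆ G) : F ⊆ G := by
  intro q hq
  obtain ⟨⟨p, hp, hpt⟩, p', hp', hpt'⟩ := hs
  rcases lt_trichotomy (l q) t with hqt | hqt | hqt
  · obtain ⟨z, hz, hzt⟩ := exists_mem_openSegment_hyperplane hpt hqt
    have hzF := hFc.openSegment_subset hp hq hz
    rw [openSegment_symm] at hz
    exact IsExposed.mem_of_openSegment hG (hF hq) (hF hp) (h ⟨hzF, hzt⟩) hz
  · exact h ⟨hq, hqt⟩
  · obtain ⟨z, hz, hzt⟩ := exists_mem_openSegment_hyperplane hqt hpt'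
    exact IsExposed.mem_of_openSegment hG (hF hq) (hF hp')
      (h ⟨hFc.openSegment_subset hq hp' hz, hzt⟩) hz

/-- A face of `Q ∩ {l ≥ t}` that leaves the hyperplane is cut out by a face of `Q`. -/
theorem exists_isExposed_inter_upperHalf_eq {Q G : Set E} (hQ : Convex ℝ Q)
    (hG : IsExposed ℝ (Q ∩ upperHalf l t) G) (hne : ∃ x ∈ G, t < l x) :
    ∃ F, IsExposed ℝ Q F ∧ F ∩ upperHalf l t = G := by
  obtain ⟨p, hp, hpt⟩ := hne
  obtain ⟨m, M, hm, hGeq⟩ := exists_eq_setOf_of_isExposed hG ⟨p, hp⟩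
  have hpQ := hG.subset hp
  have hpM : m p = M := by rw [hGeq] at hp; exact hp.2
  -- The bound holds near `p`, where `m` equals `M`; by linearity along the segment from `p` to `q`
  -- it holds at `q`.
  have hle : ∀ q ∈ Q, m q ≤ M := by
    intro q hq
    obtain ⟨z, hz, hzt⟩ := exists_mem_openSegment_upperHalf hpt q
    have hmz := hm z ⟨hQ.openSegment_subset hpQ.1 hq hz, hzt⟩
    obtain ⟨a, b, ha, hb, hab, rfl⟩ := hz
    simp only [map_add, map_smul, smul_eq_mul, hpM] at hmz
    obtain rfl : a = 1 - b := by linarith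
    refine le_of_mul_le_mul_left ?_ hb
    linarith
  refine ⟨_, isExposed_setOf_eq hle, ?_⟩
  rw [hGeq]
  ext x
  exact ⟨fun h => ⟨⟨h.1.1, h.2⟩, h.1.2⟩, fun h => ⟨⟨h.1.1, h.2⟩, h.1.2⟩⟩

/-- A face of `Q ∩ H` is cut out by a face of `Q` that lies in `H` or meets both open
halfspaces. -/
theorem IsPolytope.exists_isExposed_inter_hyperplane_eq {Q G : Set E} (hQ : IsPolytope Q)
    (hs : Splits l t Q) (hG : IsExposed ℝ (Q ∩ hyperplane l t) G) :
    ∃ F, IsExposed ℝ Q F ∧ F ∩ hyperplane l t = G ∧ (F ⊆ hyperplane l t ∨ Splits l t F) := by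
  classical
  rcases G.eq_empty_or_nonempty with rfl | hne
  · exact ⟨∅, isExposed_empty, Set.empty_inter _, Or.inl (Set.empty_subset _)⟩
  -- some face of `Q` cuts out `G`
  obtain ⟨F₀, hF₀, hF₀G⟩ : ∃ F, IsExposed ℝ Q F ∧ F ∩ hyperplane l t = G := by
    obtain ⟨m, M, hm, hGeq⟩ := exists_eq_setOf_of_isExposed hG hne
    obtain ⟨s, rfl⟩ := hQ
    have hB : ∃ v ∈ s, l v < t := by
      by_contra! h
      obtain ⟨x, hx, hxt⟩ := hs.2
      have := apply_le_of_mem_convexHull (m := -l) (M := -t) (fun v hv => by simpa using h v hv) hx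
      rw [neg_apply] at this
      linarith
    obtain ⟨c, hc⟩ := exists_tilt (m := m) (M := M) hB
      (fun v hv h => hm v ⟨subset_convexHull ℝ _ hv, h⟩) (fun u hu v hv hut hvt => by
        obtain ⟨z, hz, hzt⟩ := exists_mem_openSegment_hyperplane hut hvt
        exact ⟨z, hz, hzt, hm z ⟨(convex_convexHull ℝ _).openSegment_subset
          (subset_convexHull ℝ _ hu) (subset_convexHull ℝ _ hv) hz, hzt⟩⟩)
    -- On the hyperplane the tilted functional differs from `m` by the constant `c * t`, so it cuts
    -- out the same face there.
    have happ : ∀ x, (m + c • l) x = m x + c * l x := fun x => by simp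
    have hle : ∀ x ∈ convexHull ℝ (s : Set E), (m + c • l) x ≤ M + c * t := fun x hx =>
      apply_le_of_mem_convexHull (fun v hv => by
        have := hc v hv
        rw [happ]
        linarith) hx
    refine ⟨_, isExposed_setOf_eq hle, ?_⟩
    rw [hGeq]
    ext x
    constructor
    · rintro ⟨⟨h1, h2⟩, h3⟩
      refine ⟨⟨h1, h3⟩, ?_⟩
      have h3 : l x = t := h3
      rw [happ, h3] at h2
      linarith
    · rintro ⟨⟨h1, h2⟩, h3⟩
      refine ⟨⟨h1, ?_⟩, h2⟩
      have h2 : l x = t := h2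
      rw [happ, h2, h3]
  -- a one-sided face meets the hyperplane in a face
  by_cases hsp : Splits l t F₀
  · exact ⟨F₀, hF₀, hF₀G, Or.inr hsp⟩
  · have hGF : IsExposed ℝ F₀ G := by
      rw [Splits, not_and_or] at hsp
      rw [← hF₀G]
      rcases hsp with h | h
      · push Not at h
        exact isExposed_setOf_eq h
      · push Not at h
        have := isExposed_setOf_eq (Q := F₀) (m := -l) (M := -t) fun x hx => by simpa using h x hx
        simp only [neg_apply, neg_inj] at this
        exact this
    refine ⟨G, hQ.isExposed_trans hF₀ hGF, ?_, Or.inl ?_⟩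
    · exact Set.inter_eq_left.2 fun x hx => (hG.subset hx).2
    · exact fun x hx => (hG.subset hx).2

theorem dimRank_inter_upperHalf {F : Set E} (hF : Convex ℝ F) (hne : ∃ x ∈ F, t < l x) :
    dimRank (F ∩ upperHalf l t) = dimRank F := by
  obtain ⟨p, hp, hpt⟩ := hne
  have hp' : p ∈ F ∩ upperHalf l t := ⟨hp, hpt.le⟩
  rw [dimRank_of_nonempty ⟨p, hp'⟩, dimRank_of_nonempty ⟨p, hp⟩]
  suffices h : vectorSpan ℝ F ≤ vectorSpan ℝ (F ∩ upperHalf l t) by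
    rw [le_antisymm (vectorSpan_mono ℝ Set.inter_subset_left) h]
  rw [vectorSpan_eq_span_vsub_set_right ℝ hp, Submodule.span_le]
  rintro _ ⟨q, hq, rfl⟩
  obtain ⟨z, hz, hzt⟩ := exists_mem_openSegment_upperHalf hpt q
  have hzF := hF.openSegment_subset hp hq hz
  have hzp : z - p ∈ vectorSpan ℝ (F ∩ upperHalf l t) := vsub_mem_vectorSpan ℝ ⟨hzF, hzt⟩ hp'
  obtain ⟨a, b, ha, hb, hab, rfl⟩ := hz
  obtain rfl : a = 1 - b := by linarith
  have h : q - p = b⁻¹ • (((1 - b) • p + b • q) - p) := by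
    rw [show ((1 - b) • p + b • q) - p = b • (q - p) by module, smul_smul, inv_mul_cancel₀ hb.ne',
      one_smul]
  change q - p ∈ vectorSpan ℝ (F ∩ upperHalf l t)
  rw [h]
  exact Submodule.smul_mem _ _ hzp

theorem dimRank_inter_hyperplane [FiniteDimensional ℝ E] {F : Set E} (hF : Convex ℝ F)
    (hs : Splits l t F) : dimRank (F ∩ hyperplane l t) + 1 = dimRank F := by
  obtain ⟨z, hz⟩ := hs.nonempty_inter hF
  rw [dimRank_of_nonempty ⟨z, hz⟩, dimRank_of_nonempty ⟨z, hz.1⟩]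
  obtain ⟨⟨p, hp, hpt⟩, q, hq, hqt⟩ := hs
  set W := vectorSpan ℝ (F ∩ hyperplane l t) with hW
  have hWV : W ≤ vectorSpan ℝ F := vectorSpan_mono ℝ Set.inter_subset_left
  have hlt : W < vectorSpan ℝ F := by
    refine lt_of_le_of_ne hWV fun heq => ?_
    have h1 : p - q ∈ W := by rw [heq]; exact vsub_mem_vectorSpan ℝ hp hq
    have h2 : l (p - q) = 0 := vectorSpan_le_ker (fun x hx => hx.2) h1
    rw [map_sub] at h2
    linarith
  have hproj : ∀ x y u : E, ∀ a b : ℝ, a + b = 1 → 0 < a → 0 < b → a • x + b • y = u →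
      x - y = a⁻¹ • (u - y) := by
    rintro x y u a b hab ha hb rfl
    obtain rfl : b = 1 - a := by linarith
    rw [show a • x + (1 - a) • y - y = a • (x - y) by module, smul_smul, inv_mul_cancel₀ ha.ne',
      one_smul]
  -- Joining a point of `F` off the hyperplane to `p` or `q`, whichever is on the other side, its
  -- direction is a multiple of one ending at a crossing point; so one extra dimension suffices.
  have hle : vectorSpan ℝ F ≤ W ⊔ Submodule.span ℝ {p - q} := by
    have hzW : ∀ y ∈ F ∩ hyperplane l t, y - z ∈ W ⊔ Submodule.span ℝ {p - q} := fun y hy =>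
      Submodule.mem_sup_left (vsub_mem_vectorSpan ℝ hy hz)
    have hpq : p - q ∈ W ⊔ Submodule.span ℝ {p - q} :=
      Submodule.mem_sup_right (Submodule.mem_span_singleton_self _)
    obtain ⟨y₀, hy₀, hy₀t⟩ := exists_mem_openSegment_hyperplane hpt hqt
    have hy₀F := hF.openSegment_subset hp hq hy₀
    have hzq : q - z ∈ W ⊔ Submodule.span ℝ {p - q} := by
      obtain ⟨a, b, ha, hb, hab, rfl⟩ := hy₀
      have := hzW _ ⟨hy₀F, hy₀t⟩
      obtain rfl : b = 1 - a := by linarith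
      rw [show q - z = (a • p + (1 - a) • q - z) - a • (p - q) by module]
      exact Submodule.sub_mem _ this (Submodule.smul_mem _ _ hpq)
    have hzp : p - z ∈ W ⊔ Submodule.span ℝ {p - q} := by
      rw [show p - z = (p - q) + (q - z) by module]
      exact Submodule.add_mem _ hpq hzq
    rw [vectorSpan_eq_span_vsub_set_right ℝ hz.1, Submodule.span_le]
    rintro _ ⟨x, hx, rfl⟩
    change x - z ∈ W ⊔ Submodule.span ℝ {p - q}
    rcases lt_trichotomy (l x) t with hxt | hxt | hxt
    · obtain ⟨y, hy, hyt⟩ := exists_mem_openSegment_hyperplane hpt hxt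
      have hyF := hF.openSegment_subset hp hx hy
      rw [openSegment_symm] at hy
      obtain ⟨a, b, ha, hb, hab, hab'⟩ := hy
      rw [show x - z = (x - p) + (p - z) by module, hproj x p y a b hab ha hb hab',
        show y - p = (y - z) - (p - z) by module]
      exact Submodule.add_mem _ (Submodule.smul_mem _ _
        (Submodule.sub_mem _ (hzW y ⟨hyF, hyt⟩) hzp)) hzp
    · exact hzW x ⟨hx, hxt⟩
    · obtain ⟨y, hy, hyt⟩ := exists_mem_openSegment_hyperplane hxt hqt
      have hyF := hF.openSegment_subset hx hq hy
      obtain ⟨a, b, ha, hb, hab, hab'⟩ := hy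
      rw [show x - z = (x - q) + (q - z) by module, hproj x q y a b hab ha hb hab',
        show y - q = (y - z) - (q - z) by module]
      exact Submodule.add_mem _ (Submodule.smul_mem _ _
        (Submodule.sub_mem _ (hzW y ⟨hyF, hyt⟩) hzq)) hzq
  have h1 := Submodule.finrank_lt_finrank_of_lt hlt
  have h2 := Submodule.finrank_mono hle
  have h3 := Submodule.finrank_add_le_finrank_add_finrank W (Submodule.span ℝ {p - q})
  have h4 := finrank_span_le_card (R := ℝ) ({p - q} : Set E)
  rw [Set.toFinset_singleton, Finset.card_singleton] at h4
  omega

end Halfspaces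

/-! ### Old and new faces of the section, the recursions, and the cutting formula. -/

section Cut

variable {E : Type*} [NormedAddCommGroup E] [NormedSpace ℝ E]

theorem IsPolytope.subset_of_inter_hyperplane_subset {Q : Set E} (hQ : IsPolytope Q)
    {l : StrongDual ℝ E} {t : ℝ} {F G : Set E} (hF : IsExposed ℝ Q F) (hFs : Splits l t F)
    (hG : IsExposed ℝ Q G) (h : F ∩ hyperplane l t ⊆ G) : F ⊆ G :=
  CdIndex.subset_of_inter_hyperplane_subset (hF.convex hQ.convex) hG hF.subset hFs h

theorem Splits.not_subset_hyperplane {l : StrongDual ℝ E} {t : ℝ} {F : Set E}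
    (hF : Splits l t F) : ¬ F ⊆ hyperplane l t := by
  intro h
  obtain ⟨x, hx, hxt⟩ := hF.1
  exact hxt.ne' (h hx)

open Classical in
/-- The proper faces of the section of `Q` by the hyperplane `l = t`. -/
noncomputable def sectionFaces (Q : Set E) (l : StrongDual ℝ E) (t : ℝ) : Finset (Set E) :=
  (faces (Q ∩ hyperplane l t)).erase (Q ∩ hyperplane l t)

open Classical in
/-- The proper faces of the section of `Q` that are not faces of `Q`. -/
noncomputable def newFaces (Q : Set E) (l : StrongDual ℝ E) (t : ℝ) : Finset (Set E) :=
  (sectionFaces Q l t).filter fun F => F ∉ faces Q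

section

variable {Q : Set E} {l : StrongDual ℝ E} {t : ℝ}

theorem IsPolytope.mem_sectionFaces (hQ : IsPolytope Q) {x : Set E} :
    x ∈ sectionFaces Q l t ↔ x ≠ Q ∩ hyperplane l t ∧ IsExposed ℝ (Q ∩ hyperplane l t) x := by
  rw [sectionFaces, Finset.mem_erase, (hQ.inter_hyperplane l t).mem_faces]

theorem IsPolytope.lt_of_mem_sectionFaces (hQ : IsPolytope Q) {x : Set E}
    (hx : x ∈ sectionFaces Q l t) : x < Q ∩ hyperplane l t := by
  obtain ⟨h1, h2⟩ := hQ.mem_sectionFaces.1 hx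
  exact lt_of_le_of_ne h2.subset h1

theorem newFaces_subset : newFaces Q l t ⊆ sectionFaces Q l t := Finset.filter_subset _ _

theorem sectionFaces_neg : sectionFaces Q (-l) (-t) = sectionFaces Q l t := by
  simp only [sectionFaces, hyperplane_neg]

theorem newFaces_neg : newFaces Q (-l) (-t) = newFaces Q l t := by
  simp only [newFaces, sectionFaces_neg]

theorem IsPolytope.mem_newFaces (hQ : IsPolytope Q) (hs : Splits l t Q) {u : Set E} :
    u ∈ newFaces Q l t ↔ ∃ F, IsExposed ℝ Q F ∧ F ≠ Q ∧ Splits l t F ∧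
      F ∩ hyperplane l t = u := by
  rw [newFaces, Finset.mem_filter, hQ.mem_sectionFaces, hQ.mem_faces]
  constructor
  · rintro ⟨⟨hne, hu⟩, huQ⟩
    obtain ⟨F, hF, rfl, h | h⟩ := hQ.exists_isExposed_inter_hyperplane_eq hs hu
    · rw [Set.inter_eq_left.2 h] at huQ
      exact absurd hF huQ
    · exact ⟨F, hF, fun h' => hne (by rw [h']), h, rfl⟩
  · rintro ⟨F, hF, hFQ, hFs, rfl⟩
    refine ⟨⟨fun h => hFQ ?_, isExposed_inter _ hF⟩, fun h => ?_⟩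
    · exact hF.subset.antisymm (hQ.subset_of_inter_hyperplane_subset (IsExposed.refl Q) hs hF
        (h.superset.trans Set.inter_subset_left))
    · exact hFs.not_subset_hyperplane ((hQ.subset_of_inter_hyperplane_subset hF hFs h
        subset_rfl).trans Set.inter_subset_right)

theorem IsPolytope.mem_sectionFaces_of_not_mem_newFaces (hQ : IsPolytope Q) (hs : Splits l t Q)
    {x : Set E} : (x ∈ sectionFaces Q l t ∧ x ∉ newFaces Q l t) ↔
      IsExposed ℝ Q x ∧ x ⊆ hyperplane l t := by
  rw [newFaces, Finset.mem_filter, hQ.mem_faces, not_and_not_right]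
  constructor
  · rintro ⟨h1, h2⟩
    exact ⟨h2 h1, (hQ.lt_of_mem_sectionFaces h1).le.trans Set.inter_subset_right⟩
  · rintro ⟨h1, h2⟩
    refine ⟨hQ.mem_sectionFaces.2 ⟨?_, h1.mono Set.inter_subset_left ?_⟩, fun _ => h1⟩
    · rintro rfl
      exact hs.not_subset_hyperplane ((hQ.subset_of_inter_hyperplane_subset (IsExposed.refl Q) hs
        h1 subset_rfl).trans h2)
    · exact Set.subset_inter h1.subset h2

/-- An old face containing the cut of a split face `F` would contain `F`, yet it lies in the
hyperplane. -/
theorem IsPolytope.mem_newFaces_of_lt (hQ : IsPolytope Q) (hs : Splits l t Q) :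
    ∀ u ∈ newFaces Q l t, ∀ y ∈ sectionFaces Q l t, u < y → y ∈ newFaces Q l t := by
  intro u hu y hy huy
  by_contra h
  obtain ⟨h1, h2⟩ := (hQ.mem_sectionFaces_of_not_mem_newFaces hs).1 ⟨hy, h⟩
  obtain ⟨F, hF, -, hFs, rfl⟩ := (hQ.mem_newFaces hs).1 hu
  exact hFs.not_subset_hyperplane
    ((hQ.subset_of_inter_hyperplane_subset hF hFs h1 huy.le).trans h2)

open Classical in
/-- The contribution to the recursion at `x` of the faces of `Q` on the upper side of the
hyperplane. -/
noncomputable def upperSum (Q : Set E) (l : StrongDual ℝ E) (t : ℝ) (x : Set E) : ABPoly :=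
  ∑ F ∈ faces Q with x < F ∧ (∃ y ∈ F, t < l y) ∧ ¬ ∃ y ∈ F, l y < t,
    eVar ^ (dimRank F - dimRank x - 1) * bVar * intervalIndex (faces Q) dimRank F Q

-- A face of `Q` containing the cut of a split face contains that split face, so it is not
-- one-sided.
open Classical in
theorem IsPolytope.upperSum_eq_zero (hQ : IsPolytope Q) (hs : Splits l t Q) :
    ∀ u ∈ newFaces Q l t, upperSum Q l t u = 0 := by
  intro u hu
  obtain ⟨F, hF, -, hFs, rfl⟩ := (hQ.mem_newFaces hs).1 hu
  refine Finset.sum_eq_zero fun G hG => ?_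
  rw [Finset.mem_filter, hQ.mem_faces] at hG
  obtain ⟨hG, hlt, -, hn⟩ := hG
  exact absurd (hFs.mono (hQ.subset_of_inter_hyperplane_subset hF hFs hG hlt.le)).2 hn

end

variable [FiniteDimensional ℝ E]

theorem IsPolytope.intervalIndex_inter_upperHalf {Q : Set E} (hQ : IsPolytope Q)
    {l : StrongDual ℝ E} {t : ℝ} (hs : Splits l t Q) {F : Set E} (hF : F ∈ faces Q)
    (hne : ∃ x ∈ F, t < l x) : intervalIndex (faces Q) dimRank F Q =
      intervalIndex (faces (Q ∩ upperHalf l t)) dimRank (F ∩ upperHalf l t)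
        (Q ∩ upperHalf l t) := by
  classical
  have hQu := hQ.inter_upperHalf l t
  have hA : ∀ F, F ∈ (faces Q).filter (fun F => ∃ x ∈ F, t < l x) ↔
      IsExposed ℝ Q F ∧ ∃ x ∈ F, t < l x := by
    intro F
    rw [Finset.mem_filter, hQ.mem_faces]
  have hle : ∀ F, IsExposed ℝ Q F → (∃ x ∈ F, t < l x) → ∀ G, IsExposed ℝ Q G →
      F ∩ upperHalf l t ⊆ G ∩ upperHalf l t → F ⊆ G := fun F hF hFt G hG h =>
    subset_of_inter_upperHalf_subset (hF.convex hQ.convex) hG hF.subset hFt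
      (h.trans Set.inter_subset_left)
  refine intervalIndex_transport (A := (faces Q).filter fun F => ∃ x ∈ F, t < l x)
    (φ := fun F => F ∩ upperHalf l t) 0 hQ.dimRank_lt_of_mem_faces hQu.dimRank_lt_of_mem_faces
    (Finset.filter_subset _ _) ?_ ?_ ?_ ?_ ?_ ?_ ?_ F (Finset.mem_filter.2 ⟨hF, hne⟩)
  · intro F hF G hG h
    obtain ⟨-, x, hx, hxt⟩ := (hA F).1 hF
    exact Finset.mem_filter.2 ⟨hG, x, h.subset hx, hxt⟩
  · exact (hA Q).2 ⟨IsExposed.refl Q, hs.1⟩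
  · intro F hF
    exact hQu.mem_faces.2 (isExposed_inter _ ((hA F).1 hF).1)
  · intro F hF G hG
    obtain ⟨hF, hFt⟩ := (hA F).1 hF
    obtain ⟨hG, hGt⟩ := (hA G).1 hG
    constructor
    · rintro ⟨h1, h2⟩
      exact ⟨hle F hF hFt G hG h1, fun h => h2 (Set.inter_subset_inter_left _ h)⟩
    · rintro ⟨h1, h2⟩
      exact ⟨Set.inter_subset_inter_left _ h1, fun h => h2 (hle G hG hGt F hF h)⟩
  · intro F hF G hG h
    obtain ⟨hF, x, hx, hxt⟩ := (hA F).1 hF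
    have hxG : x ∈ G := h.subset ⟨hx, hxt.le⟩
    obtain ⟨F', hF', rfl⟩ :=
      exists_isExposed_inter_upperHalf_eq hQ.convex (hQu.mem_faces.1 hG) ⟨x, hxG, hxt⟩
    exact ⟨F', (hA F').2 ⟨hF', x, hxG.1, hxt⟩, rfl⟩
  · intro F hF G hG h
    obtain ⟨hF, hFt⟩ := (hA F).1 hF
    obtain ⟨hG, hGt⟩ := (hA G).1 hG
    exact (hle F hF hFt G hG h.subset).antisymm (hle G hG hGt F hF h.superset)
  · intro F hF
    obtain ⟨hF, hFt⟩ := (hA F).1 hF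
    exact dimRank_inter_upperHalf (hF.convex hQ.convex) hFt

theorem IsPolytope.intervalIndex_inter_hyperplane {Q : Set E} (hQ : IsPolytope Q)
    {l : StrongDual ℝ E} {t : ℝ} (hs : Splits l t Q) {F : Set E} (hF : F ∈ faces Q)
    (hFs : Splits l t F) : intervalIndex (faces Q) dimRank F Q =
      intervalIndex (faces (Q ∩ hyperplane l t)) dimRank (F ∩ hyperplane l t)
        (Q ∩ hyperplane l t) := by
  classical
  have hQh := hQ.inter_hyperplane l t
  have hA : ∀ F, F ∈ (faces Q).filter (Splits l t) ↔ IsExposed ℝ Q F ∧ Splits l t F := by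
    intro F
    rw [Finset.mem_filter, hQ.mem_faces]
  have hle : ∀ F, IsExposed ℝ Q F → Splits l t F → ∀ G, IsExposed ℝ Q G →
      F ∩ hyperplane l t ⊆ G ∩ hyperplane l t → F ⊆ G := fun F hF hFt G hG h =>
    hQ.subset_of_inter_hyperplane_subset hF hFt hG (h.trans Set.inter_subset_left)
  refine intervalIndex_transport (A := (faces Q).filter (Splits l t))
    (φ := fun F => F ∩ hyperplane l t) 1 hQ.dimRank_lt_of_mem_faces hQh.dimRank_lt_of_mem_faces
    (Finset.filter_subset _ _) ?_ ?_ ?_ ?_ ?_ ?_ ?_ F (Finset.mem_filter.2 ⟨hF, hFs⟩)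
  · intro F hF G hG h
    exact Finset.mem_filter.2 ⟨hG, ((hA F).1 hF).2.mono h.subset⟩
  · exact (hA Q).2 ⟨IsExposed.refl Q, hs⟩
  · intro F hF
    exact hQh.mem_faces.2 (isExposed_inter _ ((hA F).1 hF).1)
  · intro F hF G hG
    obtain ⟨hF, hFt⟩ := (hA F).1 hF
    obtain ⟨hG, hGt⟩ := (hA G).1 hG
    constructor
    · rintro ⟨h1, h2⟩
      exact ⟨hle F hF hFt G hG h1, fun h => h2 (Set.inter_subset_inter_left _ h)⟩
    · rintro ⟨h1, h2⟩
      exact ⟨Set.inter_subset_inter_left _ h1, fun h => h2 (hle G hG hGt F hF h)⟩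
  · intro F hF G hG h
    obtain ⟨hF, hFs⟩ := (hA F).1 hF
    obtain ⟨F', hF', rfl, hF't⟩ :=
      hQ.exists_isExposed_inter_hyperplane_eq hs (hQh.mem_faces.1 hG)
    refine ⟨F', (hA F').2 ⟨hF', hF't.resolve_left fun h' => ?_⟩, rfl⟩
    exact hFs.not_subset_hyperplane ((hle F hF hFs F' hF' h.subset).trans h')
  · intro F hF G hG h
    obtain ⟨hF, hFt⟩ := (hA F).1 hF
    obtain ⟨hG, hGt⟩ := (hA G).1 hG
    exact (hle F hF hFt G hG h.subset).antisymm (hle G hG hGt F hF h.superset)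
  · intro F hF
    obtain ⟨hF, hFt⟩ := (hA F).1 hF
    exact dimRank_inter_hyperplane (hF.convex hQ.convex) hFt

section

variable {Q : Set E} {l : StrongDual ℝ E} {t : ℝ}

open Classical in
/-- Summation over the split faces above a face of the section. -/
theorem IsPolytope.sum_splits_eq (hQ : IsPolytope Q) (hs : Splits l t Q) {x : Set E}
    (hx : x ∈ sectionFaces Q l t) :
    ∑ F ∈ faces Q with x < F ∧ F ≠ Q ∧ Splits l t F,
      eVar ^ (dimRank F - dimRank x - 1) * bVar * intervalIndex (faces Q) dimRank F Q =
    ∑ u ∈ newFaces Q l t with x ≤ u, eVar ^ (dimRank u - dimRank x) * bVar *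
      intervalIndex (faces (Q ∩ hyperplane l t)) dimRank u (Q ∩ hyperplane l t) := by
  have hxH : x ⊆ hyperplane l t :=
    (hQ.lt_of_mem_sectionFaces hx).le.trans Set.inter_subset_right
  refine Finset.sum_bij (fun F _ => F ∩ hyperplane l t) ?_ ?_ ?_ ?_
  · intro F hF
    rw [Finset.mem_filter, hQ.mem_faces] at hF
    exact Finset.mem_filter.2 ⟨(hQ.mem_newFaces hs).2 ⟨F, hF.1, hF.2.2.1, hF.2.2.2, rfl⟩,
      Set.subset_inter hF.2.1.le hxH⟩
  · intro F hF G hG h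
    rw [Finset.mem_filter, hQ.mem_faces] at hF hG
    exact (hQ.subset_of_inter_hyperplane_subset hF.1 hF.2.2.2 hG.1
      (h.subset.trans Set.inter_subset_left)).antisymm
      (hQ.subset_of_inter_hyperplane_subset hG.1 hG.2.2.2 hF.1
        (h.superset.trans Set.inter_subset_left))
  · intro u hu
    obtain ⟨hu, hxu⟩ := Finset.mem_filter.1 hu
    obtain ⟨F, hF, hFQ, hFs, rfl⟩ := (hQ.mem_newFaces hs).1 hu
    refine ⟨F, Finset.mem_filter.2 ⟨hQ.mem_faces.2 hF, ?_, hFQ, hFs⟩, rfl⟩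
    -- `x` may equal the cut of `F` but never `F` itself; hence `<` on one side of the identity and
    -- `≤` on the other.
    refine lt_of_le_of_ne (le_trans hxu Set.inter_subset_left) ?_
    rintro rfl
    exact hFs.not_subset_hyperplane hxH
  · intro F hF
    rw [Finset.mem_filter] at hF
    have h := dimRank_inter_hyperplane ((hQ.mem_faces.1 hF.1).convex hQ.convex) hF.2.2.2
    rw [hQ.intervalIndex_inter_hyperplane hs hF.1 hF.2.2.2,
      show dimRank F - dimRank x - 1 = dimRank (F ∩ hyperplane l t) - dimRank x by omega]

theorem IsPolytope.dimRank_lt_of_mem_sectionFaces (hQ : IsPolytope Q) :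
    ∀ x ∈ sectionFaces Q l t, ∀ y ∈ sectionFaces Q l t, x < y → dimRank x < dimRank y :=
  fun _ hx _ hy h => (hQ.inter_hyperplane l t).dimRank_lt_of_mem_faces _
    (Finset.mem_of_mem_erase hx) _ (Finset.mem_of_mem_erase hy) h

theorem IsPolytope.dimRank_lt_section (hQ : IsPolytope Q) :
    ∀ x ∈ sectionFaces Q l t, dimRank x < dimRank (Q ∩ hyperplane l t) :=
  fun _ hx => dimRank_lt (hQ.mem_sectionFaces.1 hx).2 subset_rfl (hQ.lt_of_mem_sectionFaces hx)

open Classical in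
/-- The recursion for the section. -/
theorem IsPolytope.section_recursion (hQ : IsPolytope Q) {x : Set E}
    (hx : x ∈ sectionFaces Q l t) {u : Set E} (hu : u ∈ faces (Q ∩ hyperplane l t)) :
    intervalIndex (faces (Q ∩ hyperplane l t)) dimRank x u =
      eVar ^ (dimRank u - dimRank x - 1) +
      ∑ y ∈ sectionFaces Q l t with x < y ∧ y < u, eVar ^ (dimRank y - dimRank x - 1) * bVar *
        intervalIndex (faces (Q ∩ hyperplane l t)) dimRank y u := by
  have hQh := hQ.inter_hyperplane l t
  rw [intervalIndex_eq_sum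
    (fun y hy h => hQh.dimRank_lt_of_mem_faces x (Finset.mem_of_mem_erase hx) y hy h)
    (fun y hy h => hQh.dimRank_lt_of_mem_faces y hy u hu h) hQh.dimRank_lt_of_mem_faces]
  congr 1
  refine Finset.sum_congr ?_ fun _ _ => rfl
  ext y
  rw [mem_between, Finset.mem_filter, sectionFaces, Finset.mem_erase]
  constructor
  · rintro ⟨h1, h2, h3⟩
    exact ⟨⟨(h3.trans_le (hQh.mem_faces.1 hu).subset).ne, h1⟩, h2, h3⟩
  · rintro ⟨⟨-, h1⟩, h2, h3⟩
    exact ⟨h1, h2, h3⟩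

open Classical in
/-- The recursion for `Q` at a face in the hyperplane. -/
theorem IsPolytope.polytope_recursion (hQ : IsPolytope Q) (hs : Splits l t Q) {x : Set E}
    (hx : x ∈ sectionFaces Q l t) (hxU : x ∉ newFaces Q l t) :
    intervalIndex (faces Q) dimRank x Q = eVar ^ (dimRank (Q ∩ hyperplane l t) - dimRank x) +
      ∑ y ∈ sectionFaces Q l t with x < y ∧ y ∉ newFaces Q l t,
        eVar ^ (dimRank y - dimRank x - 1) * bVar * intervalIndex (faces Q) dimRank y Q +
      ∑ u ∈ newFaces Q l t with x < u, eVar ^ (dimRank u - dimRank x) * bVar *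
        intervalIndex (faces (Q ∩ hyperplane l t)) dimRank u (Q ∩ hyperplane l t) +
      (upperSum Q l t x + upperSum Q (-l) (-t) x) := by
  have hxQ := ((hQ.mem_sectionFaces_of_not_mem_newFaces hs).1 ⟨hx, hxU⟩).1
  have hrank := dimRank_inter_hyperplane hQ.convex hs
  rw [intervalIndex_eq_sum
    (fun y hy h => hQ.dimRank_lt_of_mem_faces x (hQ.mem_faces.2 hxQ) y hy h)
    (fun y hy h => hQ.dimRank_lt_of_mem_faces y hy Q (hQ.mem_faces.2 (IsExposed.refl Q)) h)
    hQ.dimRank_lt_of_mem_faces,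
    show dimRank Q - dimRank x - 1 = dimRank (Q ∩ hyperplane l t) - dimRank x by omega]
  -- Since `x` is old, it is not one of the new faces.
  have hlt : ((newFaces Q l t).filter fun u => x < u) =
      (newFaces Q l t).filter fun u => x ≤ u := by
    refine Finset.filter_congr fun u hu => ⟨le_of_lt, fun h => lt_of_le_of_ne h ?_⟩
    rintro rfl
    exact hxU hu
  rw [hlt, ← hQ.sum_splits_eq hs hx]
  set g : Set E → ABPoly := fun F =>
    eVar ^ (dimRank F - dimRank x - 1) * bVar * intervalIndex (faces Q) dimRank F Q with hg
  -- The faces strictly between `x` and `Q` fall into four classes: in the hyperplane, split,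
  -- one-sided above, one-sided below.
  have hflat : ((between (faces Q) x Q).filter fun F => F ⊆ hyperplane l t) =
      (sectionFaces Q l t).filter fun y => x < y ∧ y ∉ newFaces Q l t := by
    ext y
    have hy := hQ.mem_sectionFaces_of_not_mem_newFaces hs (x := y)
    rw [Finset.mem_filter, Finset.mem_filter, mem_between, hQ.mem_faces]
    constructor
    · rintro ⟨⟨h1, h2, -⟩, h3⟩
      exact ⟨(hy.2 ⟨h1, h3⟩).1, h2, (hy.2 ⟨h1, h3⟩).2⟩
    · rintro ⟨h1, h2, h3⟩
      obtain ⟨h4, h5⟩ := hy.1 ⟨h1, h3⟩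
      refine ⟨⟨h4, h2, lt_of_le_of_ne h4.subset ?_⟩, h5⟩
      rintro rfl
      exact hs.not_subset_hyperplane h5
  have hsplit : (((between (faces Q) x Q).filter fun F => ¬ F ⊆ hyperplane l t).filter
      fun F => Splits l t F) = (faces Q).filter fun F => x < F ∧ F ≠ Q ∧ Splits l t F := by
    ext F
    simp only [Finset.mem_filter, mem_between, hQ.mem_faces]
    constructor
    · rintro ⟨⟨⟨h1, h2, h3⟩, -⟩, h4⟩
      exact ⟨h1, h2, h3.ne, h4⟩
    · rintro ⟨h1, h2, h3, h4⟩
      exact ⟨⟨⟨h1, h2, lt_of_le_of_ne h1.subset h3⟩, h4.not_subset_hyperplane⟩, h4⟩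
  have hupper : ((((between (faces Q) x Q).filter fun F => ¬ F ⊆ hyperplane l t).filter
      fun F => ¬ Splits l t F).filter fun F => ∃ y ∈ F, t < l y) =
      (faces Q).filter fun F => x < F ∧ (∃ y ∈ F, t < l y) ∧ ¬ ∃ y ∈ F, l y < t := by
    ext F
    simp only [Finset.mem_filter, mem_between, hQ.mem_faces]
    constructor
    · rintro ⟨⟨⟨⟨h1, h2, h3⟩, -⟩, h4⟩, h5⟩
      exact ⟨h1, h2, h5, fun h6 => h4 ⟨h5, h6⟩⟩
    · rintro ⟨h1, h2, h5, h6⟩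
      refine ⟨⟨⟨⟨h1, h2, lt_of_le_of_ne h1.subset ?_⟩, ?_⟩, fun h => h6 h.2⟩, h5⟩
      · rintro rfl
        exact h6 hs.2
      · intro h
        obtain ⟨y, hy, hyt⟩ := h5
        exact hyt.ne' (h hy)
  have hlower : ((((between (faces Q) x Q).filter fun F => ¬ F ⊆ hyperplane l t).filter
      fun F => ¬ Splits l t F).filter fun F => ¬ ∃ y ∈ F, t < l y) =
      (faces Q).filter fun F => x < F ∧ (∃ y ∈ F, -t < (-l) y) ∧ ¬ ∃ y ∈ F, (-l) y < -t := by
    ext F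
    simp only [Finset.mem_filter, mem_between, hQ.mem_faces, neg_apply, neg_lt_neg_iff]
    constructor
    · rintro ⟨⟨⟨⟨h1, h2, h3⟩, h4⟩, -⟩, h5⟩
      refine ⟨h1, h2, ?_, h5⟩
      obtain ⟨y, hy, hyt⟩ := Set.not_subset.1 h4
      push Not at h5
      exact ⟨y, hy, lt_of_le_of_ne (h5 y hy) hyt⟩
    · rintro ⟨h1, h2, h5, h6⟩
      refine ⟨⟨⟨⟨h1, h2, lt_of_le_of_ne h1.subset ?_⟩, ?_⟩, fun h => h6 h.1⟩, h6⟩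
      · rintro rfl
        exact h6 hs.1
      · intro h
        obtain ⟨y, hy, hyt⟩ := h5
        exact hyt.ne (h hy)
  have h1 := Finset.sum_filter_add_sum_filter_not (between (faces Q) x Q)
    (fun F => F ⊆ hyperplane l t) g
  have h2 := Finset.sum_filter_add_sum_filter_not
    ((between (faces Q) x Q).filter fun F => ¬ F ⊆ hyperplane l t) (fun F => Splits l t F) g
  have h3 := Finset.sum_filter_add_sum_filter_not
    (((between (faces Q) x Q).filter fun F => ¬ F ⊆ hyperplane l t).filter
      fun F => ¬ Splits l t F) (fun F => ∃ y ∈ F, t < l y) g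
  rw [hflat] at h1
  rw [hsplit] at h2
  rw [hupper, hlower] at h3
  change _ + ∑ F ∈ between (faces Q) x Q, g F = _
  rw [← h1, ← h2, ← h3]
  simp only [upperSum, hg]
  abel

open Classical in
/-- The recursion for the part of `Q` in the upper halfspace at a proper face of the section. -/
theorem IsPolytope.upper_recursion (hQ : IsPolytope Q) (hs : Splits l t Q) {x : Set E}
    (hx : x ∈ sectionFaces Q l t) :
    intervalIndex (faces (Q ∩ upperHalf l t)) dimRank x (Q ∩ upperHalf l t) =
      eVar ^ (dimRank (Q ∩ hyperplane l t) - dimRank x) +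
      eVar ^ (dimRank (Q ∩ hyperplane l t) - dimRank x - 1) * bVar +
      ∑ y ∈ sectionFaces Q l t with x < y, eVar ^ (dimRank y - dimRank x - 1) * bVar *
        intervalIndex (faces (Q ∩ upperHalf l t)) dimRank y (Q ∩ upperHalf l t) +
      ∑ u ∈ newFaces Q l t with x ≤ u, eVar ^ (dimRank u - dimRank x) * bVar *
        intervalIndex (faces (Q ∩ hyperplane l t)) dimRank u (Q ∩ hyperplane l t) +
      upperSum Q l t x := by
  have hQu := hQ.inter_upperHalf l t
  have hrank := dimRank_inter_hyperplane hQ.convex hs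
  have hrank' := dimRank_inter_upperHalf hQ.convex hs.1
  have hHu := isExposed_inter_hyperplane_upperHalf (l := l) (t := t) Q
  have hHlt : Q ∩ hyperplane l t < Q ∩ upperHalf l t := by
    refine lt_of_le_of_ne hHu.subset fun h => ?_
    obtain ⟨y, hy, hyt⟩ := hs.1
    have : y ∈ Q ∩ hyperplane l t := h ▸ ⟨hy, hyt.le⟩
    exact hyt.ne' this.2
  have hflatface : ∀ y, IsExposed ℝ (Q ∩ hyperplane l t) y ↔
      IsExposed ℝ (Q ∩ upperHalf l t) y ∧ y ⊆ hyperplane l t := fun y =>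
    ⟨fun h => ⟨hQu.isExposed_trans hHu h, h.subset.trans Set.inter_subset_right⟩,
      fun h => h.1.mono hHu.subset (Set.subset_inter (h.1.subset.trans Set.inter_subset_left) h.2)⟩
  have hxH := (hQ.mem_sectionFaces.1 hx).2
  have hxlt := hQ.lt_of_mem_sectionFaces hx
  -- The section is a facet of the upper part; its term is the isolated summand ending in b.
  have htop : intervalIndex (faces (Q ∩ upperHalf l t)) dimRank (Q ∩ hyperplane l t)
      (Q ∩ upperHalf l t) = 1 := by
    rw [intervalIndex_eq_sum
      (fun y hy h => hQu.dimRank_lt_of_mem_faces _ (hQu.mem_faces.2 hHu) y hy h)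
      (fun y hy h => hQu.dimRank_lt_of_mem_faces y hy _
        (hQu.mem_faces.2 (IsExposed.refl _)) h) hQu.dimRank_lt_of_mem_faces,
      show dimRank (Q ∩ upperHalf l t) - dimRank (Q ∩ hyperplane l t) - 1 = 0 by omega,
      Finset.sum_eq_zero, pow_zero, add_zero]
    intro y hy
    obtain ⟨h1, h2, h3⟩ := mem_between.1 hy
    have h4 := hQu.dimRank_lt_of_mem_faces _ (hQu.mem_faces.2 hHu) y h1 h2
    have h5 := hQu.dimRank_lt_of_mem_faces y h1 _ (hQu.mem_faces.2 (IsExposed.refl _)) h3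
    omega
  rw [intervalIndex_eq_sum
    (fun y hy h => hQu.dimRank_lt_of_mem_faces x
      (hQu.mem_faces.2 ((hflatface x).1 hxH).1) y hy h)
    (fun y hy h => hQu.dimRank_lt_of_mem_faces y hy _
      (hQu.mem_faces.2 (IsExposed.refl _)) h) hQu.dimRank_lt_of_mem_faces,
    show dimRank (Q ∩ upperHalf l t) - dimRank x - 1 =
      dimRank (Q ∩ hyperplane l t) - dimRank x by omega]
  rw [← hQ.sum_splits_eq hs hx]
  set g : Set E → ABPoly := fun F => eVar ^ (dimRank F - dimRank x - 1) * bVar *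
    intervalIndex (faces (Q ∩ upperHalf l t)) dimRank F (Q ∩ upperHalf l t) with hg
  have hflat : ((between (faces (Q ∩ upperHalf l t)) x (Q ∩ upperHalf l t)).filter
      fun F => F ⊆ hyperplane l t) =
      insert (Q ∩ hyperplane l t) ((sectionFaces Q l t).filter fun y => x < y) := by
    ext y
    rw [Finset.mem_filter, Finset.mem_insert, Finset.mem_filter, mem_between, hQu.mem_faces,
      hQ.mem_sectionFaces]
    constructor
    · rintro ⟨⟨h1, h2, h3⟩, h4⟩
      by_cases h : y = Q ∩ hyperplane l t
      · exact Or.inl h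
      · exact Or.inr ⟨⟨h, (hflatface y).2 ⟨h1, h4⟩⟩, h2⟩
    · rintro (rfl | ⟨⟨h1, h2⟩, h3⟩)
      · exact ⟨⟨hHu, hxlt, hHlt⟩, Set.inter_subset_right⟩
      · obtain ⟨h4, h5⟩ := (hflatface y).1 h2
        exact ⟨⟨h4, h3, lt_of_le_of_lt h2.subset hHlt⟩, h5⟩
  have hnot : Q ∩ hyperplane l t ∉ (sectionFaces Q l t).filter fun y => x < y := by
    rw [Finset.mem_filter, hQ.mem_sectionFaces]
    exact fun h => h.1.1 rfl
  -- Faces leaving the hyperplane come from proper faces of `Q` meeting the open upper side, with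
  -- the same dimension and the same interval above.
  have hrest : ∑ F ∈ (between (faces (Q ∩ upperHalf l t)) x (Q ∩ upperHalf l t)).filter
      (fun F => ¬ F ⊆ hyperplane l t), g F =
      ∑ F ∈ faces Q with x < F ∧ F ≠ Q ∧ ∃ y ∈ F, t < l y,
        eVar ^ (dimRank F - dimRank x - 1) * bVar * intervalIndex (faces Q) dimRank F Q := by
    have hle : ∀ F, IsExposed ℝ Q F → (∃ x ∈ F, t < l x) → ∀ G, IsExposed ℝ Q G →
        F ∩ upperHalf l t ⊆ G ∩ upperHalf l t → F ⊆ G := fun F hF hFt G hG h =>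
      subset_of_inter_upperHalf_subset (hF.convex hQ.convex) hG hF.subset hFt
        (h.trans Set.inter_subset_left)
    symm
    refine Finset.sum_bij (fun F _ => F ∩ upperHalf l t) ?_ ?_ ?_ ?_
    · intro F hF
      rw [Finset.mem_filter, hQ.mem_faces] at hF
      obtain ⟨hF, hxF, hFQ, hFt⟩ := hF
      have hnH : ¬ F ∩ upperHalf l t ⊆ hyperplane l t := by
        obtain ⟨y, hy, hyt⟩ := hFt
        exact fun h => hyt.ne' (h ⟨hy, hyt.le⟩)
      rw [Finset.mem_filter, mem_between, hQu.mem_faces]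
      refine ⟨⟨isExposed_inter _ hF, lt_of_le_of_ne ?_ ?_, lt_of_le_of_ne ?_ fun h => ?_⟩, hnH⟩
      · exact Set.subset_inter hxF.le (((hflatface x).1 hxH).1.subset.trans
          Set.inter_subset_right)
      · rintro rfl
        exact hnH (hxlt.le.trans Set.inter_subset_right)
      · exact Set.inter_subset_inter_left _ hF.subset
      · exact hFQ (hF.subset.antisymm (hle Q (IsExposed.refl Q) hs.1 F hF h.superset))
    · intro F hF G hG h
      rw [Finset.mem_filter, hQ.mem_faces] at hF hG
      exact (hle F hF.1 hF.2.2.2 G hG.1 h.subset).antisymm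
        (hle G hG.1 hG.2.2.2 F hF.1 h.superset)
    · intro G hG
      rw [Finset.mem_filter, mem_between, hQu.mem_faces] at hG
      obtain ⟨⟨hG, hxG, hGlt⟩, hGH⟩ := hG
      obtain ⟨y, hy, hyt⟩ := Set.not_subset.1 hGH
      have hyt : t < l y := lt_of_le_of_ne (hG.subset hy).2 (Ne.symm hyt)
      obtain ⟨F, hF, rfl⟩ := exists_isExposed_inter_upperHalf_eq hQ.convex hG ⟨y, hy, hyt⟩
      refine ⟨F, Finset.mem_filter.2 ⟨hQ.mem_faces.2 hF,
        lt_of_lt_of_le hxG Set.inter_subset_left, ?_, y, hy.1, hyt⟩, rfl⟩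
      rintro rfl
      exact lt_irrefl _ hGlt
    · intro F hF
      rw [Finset.mem_filter] at hF
      rw [hQ.intervalIndex_inter_upperHalf hs hF.1 hF.2.2.2]
      simp only [hg]
      rw [dimRank_inter_upperHalf ((hQ.mem_faces.1 hF.1).convex hQ.convex) hF.2.2.2]
  have hsplit : (((faces Q).filter fun F => x < F ∧ F ≠ Q ∧ ∃ y ∈ F, t < l y).filter
      fun F => ∃ y ∈ F, l y < t) = (faces Q).filter fun F => x < F ∧ F ≠ Q ∧ Splits l t F := by
    ext F
    simp only [Finset.mem_filter, and_assoc]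
    rfl
  have hupper : (((faces Q).filter fun F => x < F ∧ F ≠ Q ∧ ∃ y ∈ F, t < l y).filter
      fun F => ¬ ∃ y ∈ F, l y < t) =
      (faces Q).filter fun F => x < F ∧ (∃ y ∈ F, t < l y) ∧ ¬ ∃ y ∈ F, l y < t := by
    ext F
    simp only [Finset.mem_filter]
    constructor
    · rintro ⟨⟨h1, h2, -, h3⟩, h4⟩
      exact ⟨h1, h2, h3, h4⟩
    · rintro ⟨h1, h2, h3, h4⟩
      refine ⟨⟨h1, h2, ?_, h3⟩, h4⟩
      rintro rfl
      exact h4 hs.2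
  have h1 := Finset.sum_filter_add_sum_filter_not
    (between (faces (Q ∩ upperHalf l t)) x (Q ∩ upperHalf l t)) (fun F => F ⊆ hyperplane l t) g
  rw [hflat, hrest, Finset.sum_insert hnot, ← Finset.sum_filter_add_sum_filter_not
    ((faces Q).filter fun F => x < F ∧ F ≠ Q ∧ ∃ y ∈ F, t < l y) (fun F => ∃ y ∈ F, l y < t),
    hsplit, hupper] at h1
  change _ + ∑ F ∈ between (faces (Q ∩ upperHalf l t)) x (Q ∩ upperHalf l t), g F = _
  rw [← h1]
  simp only [upperSum, hg, htop, mul_one]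
  abel

open Classical in
theorem IsPolytope.lower_recursion (hQ : IsPolytope Q) (hs : Splits l t Q) {x : Set E}
    (hx : x ∈ sectionFaces Q l t) :
    intervalIndex (faces (Q ∩ lowerHalf l t)) dimRank x (Q ∩ lowerHalf l t) =
      eVar ^ (dimRank (Q ∩ hyperplane l t) - dimRank x) +
      eVar ^ (dimRank (Q ∩ hyperplane l t) - dimRank x - 1) * bVar +
      ∑ y ∈ sectionFaces Q l t with x < y, eVar ^ (dimRank y - dimRank x - 1) * bVar *
        intervalIndex (faces (Q ∩ lowerHalf l t)) dimRank y (Q ∩ lowerHalf l t) +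
      ∑ u ∈ newFaces Q l t with x ≤ u, eVar ^ (dimRank u - dimRank x) * bVar *
        intervalIndex (faces (Q ∩ hyperplane l t)) dimRank u (Q ∩ hyperplane l t) +
      upperSum Q (-l) (-t) x := by
  have h := hQ.upper_recursion (splits_neg.2 hs) (x := x) (by rwa [sectionFaces_neg])
  rw [sectionFaces_neg, newFaces_neg, hyperplane_neg, ← lowerHalf_eq_upperHalf_neg] at h
  exact h

theorem IsPolytope.finsum_splitFaces_eq (hQ : IsPolytope Q) (hs : Splits l t Q) :
    ∑ᶠ σ ∈ splitFaces Q l t, Psi (σ.1 ∩ hyperplane l t) * dVar *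
      PsiFaceFigure (σ.cut (hyperplane l t)) =
    ∑ u ∈ newFaces Q l t,
      intervalIndex (faces (Q ∩ hyperplane l t)) dimRank ∅ u * dVar *
        intervalIndex (faces (Q ∩ hyperplane l t)) dimRank u (Q ∩ hyperplane l t) := by
  have hQh := hQ.inter_hyperplane l t
  rw [← finsum_mem_coe_finset]
  refine finsum_mem_eq_of_bijOn (fun σ : FacePoset Q => σ.1 ∩ hyperplane l t) ⟨?_, ?_, ?_⟩ ?_
  · rintro σ ⟨h1, h2⟩
    exact (hQ.mem_newFaces hs).2 ⟨σ.1, σ.2, h1, h2, rfl⟩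
  · rintro σ ⟨h1, h2⟩ τ ⟨h3, h4⟩ h
    exact Subtype.ext ((hQ.subset_of_inter_hyperplane_subset σ.2 h2 τ.2
      (h.subset.trans Set.inter_subset_left)).antisymm
      (hQ.subset_of_inter_hyperplane_subset τ.2 h4 σ.2
        (h.superset.trans Set.inter_subset_left)))
  · intro u hu
    obtain ⟨F, hF, hFQ, hFs, rfl⟩ := (hQ.mem_newFaces hs).1 hu
    exact ⟨⟨F, hF⟩, ⟨hFQ, hFs⟩, rfl⟩
  · intro σ _
    rw [hQh.psi_face_eq (isExposed_inter _ σ.2), hQh.psiFaceFigure_eq]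
    rfl

/-- The cutting formula for the `ab`-index of a polytope. -/
theorem IsPolytope.psi_cut (hQ : IsPolytope Q) (hs : Splits l t Q) :
    Psi Q = Psi (Q ∩ upperHalf l t) + Psi (Q ∩ lowerHalf l t) -
      Psi (Q ∩ hyperplane l t) * cVar -
      ∑ᶠ σ ∈ splitFaces Q l t, Psi (σ.1 ∩ hyperplane l t) * dVar *
        PsiFaceFigure (σ.cut (hyperplane l t)) := by
  classical
  have hQh := hQ.inter_hyperplane l t
  have hQu := hQ.inter_upperHalf l t
  have hQl : IsPolytope (Q ∩ lowerHalf l t) := by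
    rw [lowerHalf_eq_upperHalf_neg]
    exact hQ.inter_upperHalf _ _
  -- The empty face is old, so the induction yields k - q there, and every new face lies strictly
  -- above it.
  have hempty := (hQ.mem_sectionFaces_of_not_mem_newFaces hs).2
    ⟨isExposed_empty, Set.empty_subset (hyperplane l t)⟩
  have key := cut_recursion (sectionFaces Q l t) (newFaces Q l t) dimRank
    (dimRank (Q ∩ hyperplane l t)) newFaces_subset (hQ.mem_newFaces_of_lt hs)
    hQ.dimRank_lt_of_mem_sectionFaces hQ.dimRank_lt_section
    (fun x => intervalIndex (faces (Q ∩ hyperplane l t)) dimRank x (Q ∩ hyperplane l t))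
    (fun x => intervalIndex (faces (Q ∩ upperHalf l t)) dimRank x (Q ∩ upperHalf l t) +
      intervalIndex (faces (Q ∩ lowerHalf l t)) dimRank x (Q ∩ lowerHalf l t))
    (fun x => intervalIndex (faces Q) dimRank x Q)
    (fun x => upperSum Q l t x + upperSum Q (-l) (-t) x)
    (fun x u => intervalIndex (faces (Q ∩ hyperplane l t)) dimRank x u)
    (fun x hx => by
      rw [hQ.section_recursion hx (hQh.mem_faces.2 (IsExposed.refl _))]
      congr 1
      refine Finset.sum_congr (Finset.filter_congr fun y hy => ?_) fun _ _ => rfl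
      exact and_iff_left (hQ.lt_of_mem_sectionFaces hy))
    (fun x hx u hu _ => hQ.section_recursion hx (Finset.mem_of_mem_erase (newFaces_subset hu)))
    (fun x hx => by
      rw [hQ.upper_recursion hs hx, hQ.lower_recursion hs hx]
      simp only [mul_add, Finset.sum_add_distrib, two_mul]
      abel)
    (fun u hu => by
      have h := hQ.upperSum_eq_zero (splits_neg.2 hs) u (by rwa [newFaces_neg])
      rw [hQ.upperSum_eq_zero hs u hu, h, add_zero])
    (fun x hx hxU => hQ.polytope_recursion hs hx hxU) ∅ hempty.1 hempty.2
  have hfilter : ((newFaces Q l t).filter fun u => ∅ < u) = newFaces Q l t := by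
    refine Finset.filter_true_of_mem fun u hu => lt_of_le_of_ne (Set.empty_subset u) ?_
    rintro rfl
    exact hempty.2 hu
  rw [hfilter, ← hQ.finsum_splitFaces_eq hs] at key
  rw [hQ.psi_eq, hQu.psi_eq, hQl.psi_eq, hQh.psi_eq, sub_sub, ← key]
  abel

end

end Cut

end CdIndex

/-- The cutting formula for the `cd`-index of a convex polytope. The hyperplane is `H = {l = t}`; it
meets the relative interior of the polytope `Q` and does not contain `Q`. -/
theorem mainTheorem3 (n : ℕ) (Q : Set (EuclideanSpace ℝ (Fin n))) (hQ : CdIndex.IsPolytope Q)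
    (l : StrongDual ℝ (EuclideanSpace ℝ (Fin n))) (hl : l ≠ 0) (t : ℝ)
    (hmeet : (CdIndex.hyperplane l t ∩ intrinsicInterior ℝ Q).Nonempty)
    (hsplit : ¬ Q ⊆ CdIndex.hyperplane l t) :
    CdIndex.Psi Q =
      CdIndex.Psi (Q ∩ CdIndex.upperHalf l t) + CdIndex.Psi (Q ∩ CdIndex.lowerHalf l t)
        - CdIndex.Psi (Q ∩ CdIndex.hyperplane l t) * CdIndex.cVar
        - ∑ᶠ σ ∈ CdIndex.splitFaces Q l t,
            CdIndex.Psi (σ.1 ∩ CdIndex.hyperplane l t) * CdIndex.dVar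
              * CdIndex.PsiFaceFigure (σ.cut (CdIndex.hyperplane l t)) :=
  hQ.psi_cut (CdIndex.splits_of_mem_intrinsicInterior hmeet hsplit)
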